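/- For a prime power $q$ and integers $n\ge 2$, $1\le k\le n$, let $f_n$ be uniformly distributed on the monic polynomials of degree $n$ over the finite field $\mathbb{F}_q$, and let $\pi_n$ be a uniformly distributed permutation of $n$ elements. Let $\Omega(f)$ be the number of monic irreducible factors of $f$ counted with multiplicity, and let $K(\pi)$ be the number of cycles of $\pi$ (fixed points included). Put $r=(k-1)/\log n$ and $$h_q(x)=\prod_{P}\left(1-\frac{x}{|P|}\right)^{-1}\left(1-\frac1{|P|}\right)^{x},\qquad |P|=q^{\deg P},$$ where $P$ runs over the monic irreducible polynomials over $\mathbb{F}_q$. Whenever $r\le 3/2$, the product defining $h_q(r)$ converges unconditionally. There is an absolute constant $C>0$ such that, for all prime powers $q$ and all integers $n\ge2$ and $1\le k\le n$ with $r\le 3/2$, $$\left|\frac{\mathbb{P}(\Omega(f_n)=k)}{\mathbb{P}(K(\pi_n)=k)}-h_q(r)\right|\le \frac{Ck}{q(\log n)^2}.$$ Consequently, as $q^n\to\infty$, $$\frac{\mathbb{P}(\Omega(f_n)=k)}{\mathbb{P}(K(\pi_n)=k)\,h_q(r)}\longrightarrow 1$$ uniformly: for every $\varepsilon>0$ there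 is $N$ such that for all prime powers $q$ and all integers $n\ge 2$, $1\le k\le n$ with $r\le 3/2$ and $q^n\ge N$, the left-hand side differs from $1$ by at most $\varepsilon$. -/

import Mathlib

open Polynomial

universe u

/-- The number `Ω(f)` of monic prime factors of `f`, counted with multiplicity. -/
noncomputable def polyOmega {F : Type*} [Field F] (f : F[X]) : ℕ :=
  open Classical in Multiset.card (UniqueFactorizationMonoid.normalizedFactors f)

/-- The number `K(π)` of cycles of a permutation `π`, fixed points included as cycles of length
one: the number of parts of the cycle partition. -/
def numCycles {n : ℕ} (π : Equiv.Perm (Fin n)) : ℕ :=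
  Multiset.card π.partition.parts

/-- The set of monic polynomials of degree `n` over `F`. -/
def monicPolys (F : Type*) [Field F] (n : ℕ) : Set F[X] :=
  {f | f.Monic ∧ f.natDegree = n}

/-- `ℙ(Ω(f_n) = k)` for `f_n` uniform on the monic polynomials of degree `n` over `F`. -/
noncomputable def probOmega (F : Type*) [Field F] (n k : ℕ) : ℝ :=
  ({f ∈ monicPolys F n | polyOmega f = k}.ncard : ℝ) / ((monicPolys F n).ncard : ℝ)

/-- `ℙ(K(π_n) = k)` for `π_n` uniform on the permutations of `n` elements. -/
noncomputable def probCycles (n k : ℕ) : ℝ :=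
  ({π : Equiv.Perm (Fin n) | numCycles π = k}.ncard : ℝ) / (Nat.card (Equiv.Perm (Fin n)) : ℝ)

/-- The set of monic irreducible polynomials over `F`. -/
def monicPrimes (F : Type*) [Field F] : Set F[X] :=
  {P | P.Monic ∧ Irreducible P}

/-- `|f| = q ^ deg f`, where `q` is the number of elements of `F`. -/
noncomputable def polyNorm {F : Type*} [Field F] (f : F[X]) : ℝ :=
  (Nat.card F : ℝ) ^ f.natDegree

/-- The factor `(1 - x / |P|)⁻¹ (1 - 1 / |P|) ^ x` of the Euler product `h_q(x)`. -/
noncomputable def hFactor {F : Type*} [Field F] (x : ℝ) (P : F[X]) : ℝ :=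
  (1 - x / polyNorm P)⁻¹ * (1 - 1 / polyNorm P) ^ x

/-- The Euler product `h_q(x)` over the monic irreducible polynomials over `F`, `q = #F`. -/
noncomputable def hFun (F : Type*) [Field F] (x : ℝ) : ℝ :=
  ∏' P : monicPrimes F, hFactor x (P : F[X])

/-- The parameter `r = (k - 1) / log n`, a real number. -/
noncomputable def rParam (n k : ℕ) : ℝ := ((k : ℝ) - 1) / Real.log (n : ℝ)

/-!
Let `A_n(z) = q ^ (-n) ∑_f z ^ Ω(f)`, over the monic `f` of degree `n`, and let `c_n(z)` be the
generating polynomial of the number of cycles of `π_n`. Weighting each prime power dividing `f` by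
the degree of the prime gives `n A_n = ∑_l g_l A_{n-l}` (`omegaSum_recurrence`), where `g_l` runs
over the prime powers of degree `l`; for permutations the same holds with `g_l` replaced by `z`. So
`∑ A_n u ^ n = (∑ c_n u ^ n) * (∑ h_j(z) u ^ j)`, where the last factor (`quotientSeries`) has the
logarithmic derivative `∑ (g_l - z) u ^ (l - 1)`. At `z = 1` the recurrence says `g_l(1) = 1`, hence
`g_l - z` only involves the proper prime powers, and in the weighted `ℓ¹` norm of polynomials with
weight `ρ = 9 / 5` it is exponentially small in `l` with total mass `O(1 / q)`. Therefore
`‖h_j‖ = O(q⁻¹ (10 / 11) ^ j)` for `j ≥ 1`, uniformly in `q`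
(`exists_weightedNorm_quotientPoly_le`).

Comparing coefficients,
`ℙ(Ω(f_n) = k) / ℙ(K(π_n) = k) = ∑_{j,i} [z ^ i] h_j * ℙ(K(π_{n-j}) = k - i) / ℙ(K(π_n) = k)`,
while `h_q(r) = ∑_{j,i} [z ^ i] h_j * r ^ i`: the logarithm of the Euler product is
`∑_l (g_l(r) - r) / l`, and `∑ h_j(r) u ^ j` solves the corresponding differential equation on
`[0, 1]` (`tsum_eq_exp_of_recurrence`, `hasProd_hFactor`).

It remains to compare the two sums termwise (`exists_abs_cycleRatio_sub_pow_le`). Here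
`ℙ(K(π_n) = k) = e_{k-1}(1, 1/2, …, 1/(n-1)) / n`, and the inequalities
`H e_m - 2 e_{m-1} ≤ (m + 1) e_{m+1} ≤ H e_m` with the harmonic number `H` give
`e_{m-1} / e_m = m / log n + O(m / (log n) ²)` for `m ≤ (3/2) log n`. The product of `i` consecutive
such ratios is `r ^ i + O(i ² (8/5) ^ i k / (log n) ²)`, and passing from `n` to `n - j` costs
`O(j ² (8/5) ^ i / n)`. Since `8 / 5 < 9 / 5`, these errors are summable against the coefficients of
the `h_j`. The asymptotic formula follows because `h_q(r)` is bounded below by a positive constant.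
-/

/-! ### Permutations counted by cycles -/

theorem numCycles_eq {n : ℕ} (π : Equiv.Perm (Fin n)) :
    numCycles π = Multiset.card π.cycleType + (n - π.support.card) := by
  simp [numCycles, Equiv.Perm.parts_partition]

/-- Cutting a non-fixed point out of its cycle creates exactly one new cycle. -/
theorem numCycles_swap_mul {n : ℕ} (f : Equiv.Perm (Fin n)) (x : Fin n) (hx : f x ≠ x) :
    numCycles (Equiv.swap x (f x) * f) = numCycles f + 1 := by
  classical
  set c := f.cycleOf x with hc
  have hcyc : c.IsCycle := Equiv.Perm.isCycle_cycleOf f hx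
  have hcx : c x = f x := Equiv.Perm.cycleOf_apply_self f x
  obtain ⟨g, hfg, hdisj⟩ : ∃ g, f = c * g ∧ c.Disjoint g := by
    refine ⟨c⁻¹ * f, by simp, ?_⟩
    have := Equiv.Perm.disjoint_mul_inv_of_mem_cycleFactorsFinset
      (f := c) (g := f) (Equiv.Perm.cycleOf_mem_cycleFactorsFinset_iff.2 (by simpa using hx))
    have hcomm : c⁻¹ * f = f * c⁻¹ := by
      have := Equiv.Perm.self_mem_cycle_factors_commute
        (c := c) (g := f) (Equiv.Perm.cycleOf_mem_cycleFactorsFinset_iff.2 (by simpa using hx))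
      exact (this.inv_left).eq
    rw [hcomm]; exact this.symm
  set s := Equiv.swap x (c x) * c with hs
  have hcx' : c x ≠ x := by rw [hcx]; exact hx
  have hsub : s.support ⊆ c.support := by
    intro y hy
    exact Equiv.Perm.mem_support.2 (Equiv.Perm.ne_and_ne_of_swap_mul_apply_ne_self
      (Equiv.Perm.mem_support.1 hy)).1
  have hdisj' : s.Disjoint g := by
    rw [Equiv.Perm.disjoint_iff_disjoint_support] at hdisj ⊢
    exact Finset.disjoint_of_subset_left hsub hdisj
  have hprod : Equiv.swap x (f x) * f = s * g := by rw [hs, hcx, mul_assoc, ← hfg]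
  have hle : c.support.card + g.support.card ≤ n := by
    rw [← hdisj.card_support_mul]
    simpa using Finset.card_le_univ (c * g).support
  have h2 := hcyc.two_le_card_support
  rw [hprod, numCycles_eq, numCycles_eq, hdisj'.cycleType_mul, hdisj'.card_support_mul, hfg,
    hdisj.cycleType_mul, hdisj.card_support_mul]
  simp only [Multiset.card_add, hcyc.cycleType, Multiset.card_singleton]
  by_cases h1 : c (c x) = x
  · have hsw := hcyc.eq_swap_of_apply_apply_eq_self hcx' h1
    have hs1 : s = 1 := by
      rw [hs]; nth_rewrite 2 [hsw]; simp
    have hcard : c.support.card = 2 := by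
      rw [hsw]; exact Equiv.Perm.card_support_swap hcx'.symm
    rw [hs1]; simp; omega
  · have hsc := hcyc.swap_mul hcx' h1
    have hcard : s.support.card + 1 = c.support.card := by
      rw [← Finset.insert_erase (Equiv.Perm.mem_support.2 hcx'), hs,
        Equiv.Perm.support_swap_mul_eq _ _ h1,
        Finset.card_insert_of_notMem (Finset.notMem_erase _ _), Finset.sdiff_singleton_eq_erase]
    rw [hsc.cycleType]; simp; omega

theorem numCycles_decomposeFin_zero {n : ℕ} (e : Equiv.Perm (Fin n)) :
    numCycles (Equiv.Perm.decomposeFin.symm (0, e)) = numCycles e + 1 := by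
  have h : Equiv.Perm.decomposeFin.symm (0, e) =
      e.extendDomain (finSuccAboveEquiv (0 : Fin (n + 1))) := by
    ext x
    refine Fin.cases ?_ (fun y => ?_) x
    · rw [Equiv.Perm.extendDomain_apply_not_subtype _ _ (by simp)]
      simp
    · have := Equiv.Perm.extendDomain_apply_image e (finSuccAboveEquiv (0 : Fin (n + 1))) y
      simp only [finSuccAboveEquiv_apply, Fin.zero_succAbove] at this
      rw [this]
      simp
  have hsupp : (e.extendDomain (finSuccAboveEquiv (0 : Fin (n + 1)))).support.card =
      e.support.card := by
    simp [← Equiv.Perm.sum_cycleType]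
  have hle : e.support.card ≤ n := by simpa using Finset.card_le_univ e.support
  rw [numCycles_eq, numCycles_eq, h, hsupp, Equiv.Perm.cycleType_extendDomain]
  omega

theorem numCycles_decomposeFin_ne {n : ℕ} (p : Fin (n + 1)) (hp : p ≠ 0) (e : Equiv.Perm (Fin n)) :
    numCycles (Equiv.Perm.decomposeFin.symm (p, e)) = numCycles e := by
  have h1 : Equiv.swap 0 p * Equiv.Perm.decomposeFin.symm (p, e) =
      Equiv.Perm.decomposeFin.symm (0, e) := by
    ext x
    refine Fin.cases ?_ (fun y => ?_) x <;> simp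
  have h2 := numCycles_swap_mul (Equiv.Perm.decomposeFin.symm (p, e)) 0 (by simpa using hp)
  rw [Equiv.Perm.decomposeFin_symm_apply_zero, h1, numCycles_decomposeFin_zero] at h2
  omega

theorem card_numCycles_eq (n k : ℕ) :
    Fintype.card {π : Equiv.Perm (Fin n) // numCycles π = k} = Nat.stirlingFirst n k := by
  induction n generalizing k with
  | zero =>
    have h0 : ∀ π : Equiv.Perm (Fin 0), numCycles π = 0 := fun π => by
      rw [numCycles_eq, Subsingleton.elim π 1]; simp
    cases k <;> simp [h0, Nat.stirlingFirst]
  | succ n ih =>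
    have hE : Fintype.card {π : Equiv.Perm (Fin (n + 1)) // numCycles π = k} =
        Fintype.card {x : Fin (n + 1) × Equiv.Perm (Fin n) //
          numCycles (Equiv.Perm.decomposeFin.symm x) = k} :=
      Fintype.card_congr (Equiv.Perm.decomposeFin.subtypeEquiv (by simp))
    rw [hE, Fintype.card_subtype, Finset.card_filter, ← Finset.univ_product_univ,
      Finset.sum_product, Fin.sum_univ_succ]
    simp only [numCycles_decomposeFin_zero,
      numCycles_decomposeFin_ne _ (Fin.succ_ne_zero _)]
    simp only [← Finset.card_filter, Finset.sum_const, Finset.card_univ, Fintype.card_fin,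
      smul_eq_mul]
    cases k with
    | zero =>
      have := ih 0
      rw [Fintype.card_subtype] at this
      rw [this]
      cases n <;> simp [Nat.stirlingFirst]
    | succ k =>
      have h1 := ih (k + 1)
      have h2 := ih k
      rw [Fintype.card_subtype] at h1 h2
      simp only [Nat.add_right_cancel_iff]
      rw [h1, h2, Nat.stirlingFirst_succ_succ, add_comm]

theorem probCycles_eq (n k : ℕ) :
    probCycles n k = (Nat.stirlingFirst n k : ℝ) / (n.factorial : ℝ) := by
  rw [probCycles, ← card_numCycles_eq, ← Nat.card_coe_set_eq, Nat.card_eq_fintype_card,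
    Nat.card_eq_fintype_card, Fintype.card_perm, Fintype.card_fin]
  congr 1

/-! ### Counting monic polynomials by their number of prime factors -/

section MonicPolys

variable {F : Type*} [Field F]

theorem polyOmega_mul {f g : F[X]} (hf : f ≠ 0) (hg : g ≠ 0) :
    polyOmega (f * g) = polyOmega f + polyOmega g := by
  classical
  simp [polyOmega, UniqueFactorizationMonoid.normalizedFactors_mul hf hg]

theorem polyOmega_pow_of_irreducible {P : F[X]} (hP : Irreducible P) (m : ℕ) :
    polyOmega (P ^ m) = m := by
  classical
  simp [polyOmega, hP.normalizedFactors_pow]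

variable (F) in
theorem ncard_monicPolys [Finite F] (n : ℕ) : (monicPolys F n).ncard = Nat.card F ^ n := by
  rw [← Nat.card_coe_set_eq]
  change Nat.card {p : F[X] // p.Monic ∧ p.natDegree = n} = _
  rw [Nat.card_congr ((monicEquivDegreeLT n).trans (degreeLTEquiv F n).toEquiv), Nat.card_fun]
  simp

variable (F) in
theorem finite_monicPolys [Finite F] (n : ℕ) : (monicPolys F n).Finite :=
  Set.finite_of_ncard_pos (by rw [ncard_monicPolys]; exact pow_pos Nat.card_pos n)

variable (F) in
/-- The monic polynomials of degree `n` over a finite field, as a `Finset`. -/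
noncomputable def monicFinset [Finite F] (n : ℕ) : Finset F[X] := (finite_monicPolys F n).toFinset

theorem mem_monicFinset [Finite F] {n : ℕ} {f : F[X]} :
    f ∈ monicFinset F n ↔ f.Monic ∧ f.natDegree = n := by
  simp [monicFinset, monicPolys]

variable (F) in
theorem card_monicFinset [Finite F] (n : ℕ) : (monicFinset F n).card = Nat.card F ^ n := by
  rw [← ncard_monicPolys, monicFinset, Set.ncard_eq_toFinset_card _ (finite_monicPolys F n)]

open Classical in
variable (F) in
/-- The monic irreducible polynomials of degree `n` over a finite field, as a `Finset`. -/
noncomputable def primeFinset [Finite F] (n : ℕ) : Finset F[X] :=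
  (monicFinset F n).filter Irreducible

theorem mem_primeFinset [Finite F] {n : ℕ} {f : F[X]} :
    f ∈ primeFinset F n ↔ f.Monic ∧ f.natDegree = n ∧ Irreducible f := by
  simp [primeFinset, mem_monicFinset, and_assoc]

open Classical in
/-- The degree of a monic `f` counts the prime powers dividing `f`, each weighted by the degree of
the prime. -/
theorem sum_degree_primePow_dvd [Finite F] {n : ℕ} {f : F[X]} (hf : f.Monic)
    (hn : f.natDegree = n) :
    ∑ d ∈ Finset.Icc 1 n, ∑ P ∈ primeFinset F d, ∑ m ∈ Finset.Icc 1 n,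
      (if P ^ m ∣ f then d else 0) = n := by
  set s := UniqueFactorizationMonoid.normalizedFactors f with hs
  have hprod : s.prod = f := by
    rw [hs, UniqueFactorizationMonoid.prod_normalizedFactors_eq hf.ne_zero, hf.normalize_eq_self]
  have hmem : ∀ P ∈ s, P.Monic ∧ Irreducible P := by
    intro P hP
    have hi := UniqueFactorizationMonoid.irreducible_of_normalized_factor P hP
    refine ⟨?_, hi⟩
    rw [← normalize_eq_self_iff_monic hi.ne_zero]
    exact UniqueFactorizationMonoid.normalize_normalized_factor P hP
  have hdeg : (s.map natDegree).sum = n := by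
    rw [← hn]
    conv_rhs => rw [← hprod]
    rw [natDegree_multiset_prod_of_monic _ (fun P hP => (hmem P hP).1)]
  have hle : ∀ P ∈ s, P.natDegree ∈ Finset.Icc 1 n := by
    intro P hP
    refine Finset.mem_Icc.2 ⟨(hmem P hP).2.natDegree_pos, ?_⟩
    rw [← hdeg]
    exact Multiset.single_le_sum (fun _ _ => Nat.zero_le _) _ (Multiset.mem_map_of_mem _ hP)
  have hcount : ∀ P : F[X], P.Monic → Irreducible P →
      ∀ m : ℕ, P ^ m ∣ f ↔ m ≤ s.count P := by
    intro P hP hi m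
    rw [pow_dvd_iff_le_emultiplicity,
      UniqueFactorizationMonoid.emultiplicity_eq_count_normalizedFactors hi hf.ne_zero,
      hP.normalize_eq_self]
    exact Nat.cast_le
  have hcardle : s.card ≤ n := by
    rw [← hdeg]
    have := Multiset.card_nsmul_le_sum (s := s.map natDegree) (a := 1) (by
      intro x hx
      obtain ⟨P, hP, rfl⟩ := Multiset.mem_map.1 hx
      exact (Finset.mem_Icc.1 (hle P hP)).1)
    simpa using this
  have hm : ∀ d, ∀ P ∈ primeFinset F d, ∑ m ∈ Finset.Icc 1 n, (if P ^ m ∣ f then d else 0) =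
      s.count P * P.natDegree := by
    intro d P hP
    obtain ⟨h1, h2, h3⟩ := mem_primeFinset.1 hP
    rw [← Finset.sum_filter, Finset.sum_const, smul_eq_mul, h2]
    congr 1
    have : (Finset.Icc 1 n).filter (fun m => P ^ m ∣ f) = Finset.Icc 1 (s.count P) := by
      ext m
      have := (Multiset.count_le_card P s).trans hcardle
      simp only [Finset.mem_filter, Finset.mem_Icc, hcount P h1 h3]
      omega
    rw [this]; simp
  rw [Finset.sum_congr rfl fun d _ => Finset.sum_congr rfl (hm d)]
  conv_rhs => rw [← hdeg, Finset.sum_multiset_map_count]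
  rw [← Finset.sum_fiberwise_of_maps_to (s := s.toFinset) (t := Finset.Icc 1 n) (g := natDegree)
    (fun P hP => hle P (Multiset.mem_toFinset.1 hP))]
  refine Finset.sum_congr rfl fun d _ => ?_
  symm
  simp only [smul_eq_mul]
  refine Finset.sum_subset ?_ ?_
  · intro P hP
    obtain ⟨h1, h2⟩ := Finset.mem_filter.1 hP
    obtain ⟨h3, h4⟩ := hmem P (Multiset.mem_toFinset.1 h1)
    exact mem_primeFinset.2 ⟨h3, h2, h4⟩
  · intro P hP hnot
    have : P ∉ s := fun h => hnot (Finset.mem_filter.2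
      ⟨Multiset.mem_toFinset.2 h, (mem_primeFinset.1 hP).2.1⟩)
    simp [Multiset.count_eq_zero_of_notMem this]

/-- A double sum over `d, m ≥ 1` with `d * m ≤ n`, grouped by the value of `d * m`. -/
theorem sum_Icc_mul_eq_sum_divisorsAntidiagonal {M : Type*} [AddCommMonoid M] (n : ℕ)
    (f : ℕ → ℕ → M) :
    ∑ d ∈ Finset.Icc 1 n, ∑ m ∈ Finset.Icc 1 n, (if d * m ≤ n then f d m else 0) =
      ∑ l ∈ Finset.Icc 1 n, ∑ x ∈ l.divisorsAntidiagonal, f x.1 x.2 := by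
  rw [← Finset.sum_product', ← Finset.sum_filter, Finset.sum_sigma']
  refine Finset.sum_bij' (fun x _ => ⟨x.1 * x.2, x⟩) (fun y _ => y.2) ?_ ?_ ?_ ?_ ?_
  · rintro ⟨d, m⟩ h
    simp only [Finset.mem_filter, Finset.mem_product, Finset.mem_Icc] at h
    simp only [Finset.mem_sigma, Finset.mem_Icc, Nat.mem_divisorsAntidiagonal]
    have := Nat.mul_pos (show 0 < d by omega) (show 0 < m by omega)
    exact ⟨⟨this, h.2⟩, trivial, this.ne'⟩
  · rintro ⟨l, d, m⟩ h
    simp only [Finset.mem_sigma, Finset.mem_Icc, Nat.mem_divisorsAntidiagonal] at h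
    obtain ⟨⟨h1, h2⟩, rfl, h3⟩ := h
    have hd : 0 < d := Nat.pos_of_ne_zero (left_ne_zero_of_mul h3)
    have hm : 0 < m := Nat.pos_of_ne_zero (right_ne_zero_of_mul h3)
    have := Nat.le_mul_of_pos_right d hm
    have := Nat.le_mul_of_pos_left m hd
    simp only [Finset.mem_filter, Finset.mem_product, Finset.mem_Icc]
    omega
  · rintro ⟨d, m⟩ _; rfl
  · rintro ⟨l, d, m⟩ h
    simp only [Finset.mem_sigma, Finset.mem_Icc, Nat.mem_divisorsAntidiagonal] at h
    obtain ⟨_, rfl, _⟩ := h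
    rfl
  · rintro ⟨d, m⟩ _; rfl

variable (F) in
/-- The sum of `z ^ Ω(f)` over the monic `f` of degree `n`, as a polynomial in `z`. -/
noncomputable def omegaSum [Finite F] (n : ℕ) : ℝ[X] :=
  ∑ f ∈ monicFinset F n, X ^ polyOmega f

open Classical in
theorem sum_primePow_dvd [Finite F] {n m : ℕ} {P : F[X]} (hP : P.Monic) (hi : Irreducible P) :
    ∑ f ∈ (monicFinset F n).filter (P ^ m ∣ ·), (X : ℝ[X]) ^ polyOmega f =
      if P.natDegree * m ≤ n then X ^ m * omegaSum F (n - P.natDegree * m) else 0 := by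
  have hdeg : (P ^ m).natDegree = P.natDegree * m := by rw [natDegree_pow, mul_comm]
  split_ifs with h
  · rw [omegaSum, Finset.mul_sum]
    symm
    refine Finset.sum_bij (fun g _ => P ^ m * g) ?_ ?_ ?_ ?_
    · intro g hg
      obtain ⟨h1, h2⟩ := mem_monicFinset.1 hg
      refine Finset.mem_filter.2 ⟨mem_monicFinset.2 ⟨(hP.pow m).mul h1, ?_⟩, dvd_mul_right _ _⟩
      rw [(hP.pow m).natDegree_mul h1, hdeg, h2]; omega
    · intro g _ g' _ h
      exact mul_left_cancel₀ (hP.pow m).ne_zero h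
    · intro f hf
      obtain ⟨h1, g, rfl⟩ := Finset.mem_filter.1 hf
      obtain ⟨h2, h3⟩ := mem_monicFinset.1 h1
      have hg := (hP.pow m).of_mul_monic_left h2
      refine ⟨g, mem_monicFinset.2 ⟨hg, ?_⟩, rfl⟩
      rw [(hP.pow m).natDegree_mul hg, hdeg] at h3
      omega
    · intro g hg
      rw [polyOmega_mul (hP.pow m).ne_zero (mem_monicFinset.1 hg).1.ne_zero,
        polyOmega_pow_of_irreducible hi, pow_add]
  · refine Finset.sum_eq_zero fun f hf => absurd ?_ h
    obtain ⟨h1, h2⟩ := Finset.mem_filter.1 hf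
    obtain ⟨h3, h4⟩ := mem_monicFinset.1 h1
    rw [← hdeg, ← h4]
    exact natDegree_le_of_dvd h2 h3.ne_zero

variable (F) in
/-- The generating polynomial in `z` of the prime powers `P ^ m` of degree `l`, with weight
`deg P * z ^ m`. -/
noncomputable def primePowerSum [Finite F] (l : ℕ) : ℝ[X] :=
  ∑ x ∈ l.divisorsAntidiagonal, C ((x.1 * (primeFinset F x.1).card : ℕ) : ℝ) * X ^ x.2

variable (F) in
theorem omegaSum_recurrence [Finite F] (n : ℕ) :
    (n : ℝ[X]) * omegaSum F n =
      ∑ l ∈ Finset.Icc 1 n, primePowerSum F l * omegaSum F (n - l) := by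
  classical
  have h1 : (n : ℝ[X]) * omegaSum F n = ∑ d ∈ Finset.Icc 1 n, ∑ m ∈ Finset.Icc 1 n,
      (if d * m ≤ n then (C ((d * (primeFinset F d).card : ℕ) : ℝ) * X ^ m) *
        omegaSum F (n - d * m) else 0) := by
    calc (n : ℝ[X]) * omegaSum F n
        = ∑ f ∈ monicFinset F n, ((∑ d ∈ Finset.Icc 1 n, ∑ P ∈ primeFinset F d,
            ∑ m ∈ Finset.Icc 1 n, (if P ^ m ∣ f then d else 0) : ℕ) : ℝ[X]) *
            X ^ polyOmega f := by
          rw [omegaSum, Finset.mul_sum]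
          refine Finset.sum_congr rfl fun f hf => ?_
          obtain ⟨h1, h2⟩ := mem_monicFinset.1 hf
          rw [sum_degree_primePow_dvd h1 h2]
      _ = ∑ d ∈ Finset.Icc 1 n, ∑ P ∈ primeFinset F d, ∑ m ∈ Finset.Icc 1 n,
            (d : ℝ[X]) * ∑ f ∈ (monicFinset F n).filter (P ^ m ∣ ·), X ^ polyOmega f := by
          push_cast
          simp only [Finset.sum_mul]
          rw [Finset.sum_comm]
          refine Finset.sum_congr rfl fun d _ => ?_
          rw [Finset.sum_comm]
          refine Finset.sum_congr rfl fun P _ => ?_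
          rw [Finset.sum_comm]
          refine Finset.sum_congr rfl fun m _ => ?_
          rw [Finset.sum_filter, Finset.mul_sum]
          refine Finset.sum_congr rfl fun f _ => ?_
          split_ifs <;> simp
      _ = _ := by
          refine Finset.sum_congr rfl fun d _ => ?_
          rw [Finset.sum_comm]
          refine Finset.sum_congr rfl fun m _ => ?_
          have : ∀ P ∈ primeFinset F d,
              (d : ℝ[X]) * ∑ f ∈ (monicFinset F n).filter (P ^ m ∣ ·), X ^ polyOmega f =
              (d : ℝ[X]) * (if d * m ≤ n then X ^ m * omegaSum F (n - d * m) else 0) := by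
            intro P hP
            obtain ⟨h1, h2, h3⟩ := mem_primeFinset.1 hP
            rw [sum_primePow_dvd h1 h3, h2]
          rw [Finset.sum_congr rfl this, Finset.sum_const, nsmul_eq_mul]
          split_ifs
          · simp; ring
          · simp
  rw [h1, sum_Icc_mul_eq_sum_divisorsAntidiagonal n (fun d m =>
    (C ((d * (primeFinset F d).card : ℕ) : ℝ) * X ^ m) * omegaSum F (n - d * m))]
  refine Finset.sum_congr rfl fun l _ => ?_
  rw [primePowerSum, Finset.sum_mul]
  refine Finset.sum_congr rfl fun x hx => ?_
  rw [(Nat.mem_divisorsAntidiagonal.1 hx).1]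

end MonicPolys

/-! ### Elementary symmetric functions of `1, 1/2, …, 1/n` -/

/-- The `m`-th elementary symmetric function of `1, 1/2, …, 1/n`, expressed through Stirling numbers
of the first kind. -/
noncomputable def harmonicEsymm (n m : ℕ) : ℝ :=
  (Nat.stirlingFirst (n + 1) (m + 1) : ℝ) / (n.factorial : ℝ)

theorem harmonicEsymm_zero_right (n : ℕ) : harmonicEsymm n 0 = 1 := by
  have : (n.factorial : ℝ) ≠ 0 := by positivity
  simp [harmonicEsymm, Nat.stirlingFirst_one_right, this]

theorem harmonicEsymm_zero_succ (m : ℕ) : harmonicEsymm 0 (m + 1) = 0 := by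
  simp [harmonicEsymm, Nat.stirlingFirst_eq_zero_of_lt]

theorem harmonicEsymm_succ_succ (n m : ℕ) :
    harmonicEsymm (n + 1) (m + 1) =
      harmonicEsymm n (m + 1) + harmonicEsymm n m / ((n : ℝ) + 1) := by
  rw [harmonicEsymm, harmonicEsymm, harmonicEsymm, Nat.stirlingFirst_succ_succ (n + 1),
    Nat.factorial_succ]
  have : (n.factorial : ℝ) ≠ 0 := by positivity
  push_cast
  field_simp

theorem harmonicEsymm_nonneg (n m : ℕ) : 0 ≤ harmonicEsymm n m := by
  rw [harmonicEsymm]; positivity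

theorem harmonicEsymm_pos {n m : ℕ} (h : m ≤ n) : 0 < harmonicEsymm n m := by
  induction n generalizing m with
  | zero => obtain rfl : m = 0 := by omega
            simp [harmonicEsymm_zero_right]
  | succ n ih =>
    cases m with
    | zero => simp [harmonicEsymm_zero_right]
    | succ m =>
      rw [harmonicEsymm_succ_succ]
      have := ih (m := m) (by omega)
      have := harmonicEsymm_nonneg n (m + 1)
      positivity

theorem probCycles_succ_succ (n m : ℕ) :
    probCycles (n + 1) (m + 1) = harmonicEsymm n m / ((n : ℝ) + 1) := by
  rw [probCycles_eq, harmonicEsymm, Nat.factorial_succ]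
  have : (n.factorial : ℝ) ≠ 0 := by positivity
  push_cast
  field_simp

theorem harmonicEsymm_one (n : ℕ) : harmonicEsymm n 1 = (harmonic n : ℝ) := by
  induction n with
  | zero => simp [harmonicEsymm_zero_succ]
  | succ n ih =>
    rw [harmonicEsymm_succ_succ, ih, harmonicEsymm_zero_right, harmonic_succ]
    push_cast
    ring

/-- Newton's identity `(m + 1) e_{m+1} = p_1 e_m - p_2 e_{m-1} + ⋯`, truncated after its first
term. -/
theorem succ_mul_harmonicEsymm_le (n m : ℕ) :
    ((m : ℝ) + 1) * harmonicEsymm n (m + 1) ≤ (harmonic n : ℝ) * harmonicEsymm n m := by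
  induction n generalizing m with
  | zero => simp [harmonicEsymm_zero_succ]
  | succ n ih =>
    cases m with
    | zero => simp [harmonicEsymm_one, harmonicEsymm_zero_right]
    | succ m =>
      have h1 := ih (m + 1)
      have h2 := ih m
      rw [harmonicEsymm_succ_succ, harmonicEsymm_succ_succ, harmonic_succ]
      push_cast at *
      rw [div_eq_mul_inv, div_eq_mul_inv]
      set t : ℝ := ((n : ℝ) + 1)⁻¹
      have ht : 0 ≤ t := by positivity
      have h4 := mul_nonneg (mul_nonneg ht ht) (harmonicEsymm_nonneg n m)
      nlinarith

theorem sum_inv_sq_le (n : ℕ) :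
    ∑ i ∈ Finset.range n, (((i : ℝ) + 1)⁻¹) ^ 2 ≤ 2 - (n : ℝ)⁻¹ := by
  induction n with
  | zero => simp
  | succ n ih =>
    rw [Finset.sum_range_succ]
    rcases Nat.eq_zero_or_pos n with rfl | hn
    · simp; norm_num
    · have hn' : (0 : ℝ) < n := by exact_mod_cast hn
      have : (((n : ℝ) + 1)⁻¹) ^ 2 ≤ (n : ℝ)⁻¹ - ((n : ℝ) + 1)⁻¹ := by
        rw [inv_sub_inv (by positivity) (by positivity), inv_pow, inv_eq_one_div]
        rw [div_le_div_iff₀ (by positivity) (by positivity)]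
        nlinarith
      push_cast
      linarith

/-- Newton's identity `(m + 1) e_{m+1} = p_1 e_m - p_2 e_{m-1} + ⋯` truncated after its second term,
where `p_2` is the sum of the squares `1 / i ^ 2`. -/
theorem le_succ_mul_harmonicEsymm (n m : ℕ) :
    (harmonic n : ℝ) * harmonicEsymm n (m + 1) -
      (∑ i ∈ Finset.range n, (((i : ℝ) + 1)⁻¹) ^ 2) * harmonicEsymm n m ≤
      ((m : ℝ) + 2) * harmonicEsymm n (m + 2) := by
  induction n generalizing m with
  | zero => simp [harmonicEsymm_zero_succ]
  | succ n ih =>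
    have h1 := ih m
    rw [Finset.sum_range_succ]
    cases m with
    | zero =>
      rw [harmonicEsymm_succ_succ, harmonicEsymm_succ_succ, harmonic_succ] at *
      rw [harmonicEsymm_zero_right, harmonicEsymm_zero_right, harmonicEsymm_one] at *
      push_cast at *
      rw [div_eq_mul_inv, div_eq_mul_inv]
      set t : ℝ := ((n : ℝ) + 1)⁻¹
      nlinarith
    | succ m =>
      have h2 := ih m
      rw [harmonicEsymm_succ_succ, harmonicEsymm_succ_succ n (m + 1 + 1),
        harmonicEsymm_succ_succ n m, harmonic_succ]
      push_cast at *
      rw [div_eq_mul_inv, div_eq_mul_inv, div_eq_mul_inv]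
      set t : ℝ := ((n : ℝ) + 1)⁻¹
      have ht : 0 ≤ t := by positivity
      have h4 := mul_nonneg (mul_nonneg ht (sq_nonneg t)) (harmonicEsymm_nonneg n m)
      have e1 : m + 1 + 1 = m + 2 := rfl
      have e2 : m + 1 + 2 = m + 2 + 1 := rfl
      rw [e1, e2] at *
      nlinarith

theorem harmonicEsymm_mono {a b : ℕ} (h : a ≤ b) (s : ℕ) :
    harmonicEsymm a s ≤ harmonicEsymm b s := by
  induction b, h using Nat.le_induction with
  | base => rfl
  | succ b _ ih =>
    cases s with
    | zero => simp [harmonicEsymm_zero_right]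
    | succ s =>
      rw [harmonicEsymm_succ_succ]
      have := harmonicEsymm_nonneg b s
      have : 0 ≤ harmonicEsymm b s / ((b : ℝ) + 1) := by positivity
      linarith

theorem harmonicEsymm_add_le (a j s : ℕ) :
    harmonicEsymm (a + j) (s + 1) ≤
      harmonicEsymm a (s + 1) + (j : ℝ) / ((a : ℝ) + 1) * harmonicEsymm (a + j) s := by
  induction j with
  | zero => simp
  | succ j ih =>
    rw [← add_assoc, harmonicEsymm_succ_succ]
    have h1 := harmonicEsymm_nonneg (a + j) s
    have h2 := harmonicEsymm_mono (Nat.le_succ (a + j)) s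
    have h3 : harmonicEsymm (a + j) s / ((a : ℝ) + j + 1) ≤
        1 / ((a : ℝ) + 1) * harmonicEsymm (a + j) s := by
      rw [one_div_mul_eq_div]
      gcongr
      linarith [(Nat.cast_nonneg j : (0 : ℝ) ≤ j)]
    have h4 : ((j : ℝ) + 1) / ((a : ℝ) + 1) * harmonicEsymm (a + j) s ≤
        ((j : ℝ) + 1) / ((a : ℝ) + 1) * harmonicEsymm (a + j + 1) s := by gcongr
    push_cast
    rw [add_div, add_mul] at h4 ⊢
    linarith

/-! ### Ratios of consecutive elementary symmetric functions -/

/-- The ratio `e_{m-1} / e_m` of elementary symmetric functions of `1, 1/2, …, 1/n`, with `e_{-1}`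
read as `0`. -/
noncomputable def esymmRatio (n : ℕ) : ℕ → ℝ
  | 0 => 0
  | m + 1 => harmonicEsymm n m / harmonicEsymm n (m + 1)

theorem esymmRatio_nonneg (n m : ℕ) : 0 ≤ esymmRatio n m := by
  cases m with
  | zero => simp [esymmRatio]
  | succ m => exact div_nonneg (harmonicEsymm_nonneg _ _) (harmonicEsymm_nonneg _ _)

theorem succ_mul_harmonicEsymm_ge {n m : ℕ} (h : m ≤ n) :
    ((harmonic n : ℝ) - 2 * esymmRatio n m) * harmonicEsymm n m ≤
      ((m : ℝ) + 1) * harmonicEsymm n (m + 1) := by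
  cases m with
  | zero => simp [esymmRatio, harmonicEsymm_zero_right, harmonicEsymm_one]
  | succ m =>
    have h1 := le_succ_mul_harmonicEsymm n m
    have h2 := sum_inv_sq_le n
    have h3 : (0 : ℝ) ≤ (n : ℝ)⁻¹ := by positivity
    have h4 := mul_le_mul_of_nonneg_right (h2.trans (sub_le_self _ h3)) (harmonicEsymm_nonneg n m)
    have h5 : esymmRatio n (m + 1) * harmonicEsymm n (m + 1) = harmonicEsymm n m :=
      div_mul_cancel₀ _ (harmonicEsymm_pos h).ne'
    have e1 : m + 1 + 1 = m + 2 := rfl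
    push_cast
    rw [e1]
    nlinarith

/-- For `m ≤ (3/2) log (n+1)` the ratio `e_{m-1} / e_m` is bounded by `8/5`. With this
bound fed back into the recurrence, it is `m / log (n+1)` up to a relative error `O(1 / log n)`. The
threshold `52` is what the induction for `8/5` needs: `(3/2) L / (L - 2 * (8/5)) ≤ 8/5`. -/
theorem esymmRatio_bounds {n m : ℕ} (hL : 52 ≤ Real.log ((n : ℝ) + 1)) (hm : m ≤ n)
    (hmL : (m : ℝ) ≤ 3 / 2 * Real.log ((n : ℝ) + 1)) :
    esymmRatio n m ≤ 8 / 5 ∧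
      |esymmRatio n m - m / Real.log ((n : ℝ) + 1)| ≤ 4 * m / Real.log ((n : ℝ) + 1) ^ 2 := by
  set L := Real.log ((n : ℝ) + 1) with hLdef
  have hH : L ≤ (harmonic n : ℝ) := by
    have := log_add_one_le_harmonic n
    push_cast at this
    exact this
  have hH' : (harmonic n : ℝ) ≤ L + 1 := by
    have h1 := harmonic_le_one_add_log n
    have h2 : Real.log n ≤ L := by
      rcases Nat.eq_zero_or_pos n with rfl | hn
      · simp [hLdef]
      · exact Real.log_le_log (by exact_mod_cast hn) (by linarith)
    linarith
  induction m with
  | zero => simp [esymmRatio]; norm_num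
  | succ m ih =>
    push_cast at hmL
    have h1 := (ih (by omega) (by linarith)).1
    have he := harmonicEsymm_pos (n := n) (m := m) (by omega)
    have he' := harmonicEsymm_pos hm
    have h2 := succ_mul_harmonicEsymm_ge (n := n) (m := m) (by omega)
    have h3 := succ_mul_harmonicEsymm_le n m
    have hup : esymmRatio n (m + 1) ≤ ((m : ℝ) + 1) / (L - 16 / 5) := by
      rw [esymmRatio, div_le_div_iff₀ he' (by linarith)]
      have : (L - 16 / 5) * harmonicEsymm n m ≤
          ((harmonic n : ℝ) - 2 * esymmRatio n m) * harmonicEsymm n m := by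
        gcongr; linarith
      linarith
    have hlo : ((m : ℝ) + 1) / (L + 1) ≤ esymmRatio n (m + 1) := by
      rw [esymmRatio, div_le_div_iff₀ (by linarith) he']
      have : (harmonic n : ℝ) * harmonicEsymm n m ≤ (L + 1) * harmonicEsymm n m := by gcongr
      linarith
    refine ⟨hup.trans ?_, ?_⟩
    · rw [div_le_iff₀ (by linarith)]; linarith
    · push_cast
      have hd1 : ((m : ℝ) + 1) / (L - 16 / 5) ≤
          ((m : ℝ) + 1) / L + 4 * ((m : ℝ) + 1) / L ^ 2 := by
        rw [div_add_div _ _ (by positivity) (by positivity),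
          div_le_div_iff₀ (by linarith) (by positivity)]
        have : (m + 1) * (L * L ^ 2) ≤ (m + 1 : ℝ) * ((L ^ 2 + L * 4) * (L - 16 / 5)) :=
          mul_le_mul_of_nonneg_left (by nlinarith) (by positivity)
        linarith
      have hd2 : ((m : ℝ) + 1) / L - 4 * ((m : ℝ) + 1) / L ^ 2 ≤ ((m : ℝ) + 1) / (L + 1) := by
        rw [div_sub_div _ _ (by positivity) (by positivity),
          div_le_div_iff₀ (by positivity) (by linarith)]
        have : (m + 1 : ℝ) * ((L ^ 2 - L * 4) * (L + 1)) ≤ (m + 1) * (L * L ^ 2) :=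
          mul_le_mul_of_nonneg_left (by nlinarith) (by positivity)
        linarith
      rw [abs_le]
      constructor <;> linarith

/-- The ratio `e_{K-i} / e_K` as a telescoping product; it vanishes for `i > K`. -/
noncomputable def esymmRatioProd (n K i : ℕ) : ℝ :=
  ∏ l ∈ Finset.range i, esymmRatio n (K - l)

theorem esymmRatioProd_succ (n K i : ℕ) :
    esymmRatioProd n K (i + 1) = esymmRatioProd n K i * esymmRatio n (K - i) :=
  Finset.prod_range_succ _ _

theorem esymmRatioProd_nonneg (n K i : ℕ) : 0 ≤ esymmRatioProd n K i :=
  Finset.prod_nonneg fun _ _ => esymmRatio_nonneg _ _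

theorem esymmRatioProd_eq {n K i : ℕ} (hK : K ≤ n) (hi : i ≤ K) :
    esymmRatioProd n K i = harmonicEsymm n (K - i) / harmonicEsymm n K := by
  induction i with
  | zero => simp [esymmRatioProd, div_self (harmonicEsymm_pos hK).ne']
  | succ i ih =>
    rw [esymmRatioProd_succ, ih (by omega)]
    obtain ⟨s, hs⟩ : ∃ s, K - i = s + 1 := ⟨K - i - 1, by omega⟩
    have hs' : K - (i + 1) = s := by omega
    have := (harmonicEsymm_pos (n := n) (m := s + 1) (by omega)).ne'
    rw [hs, hs', esymmRatio]
    field_simp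

theorem esymmRatioProd_eq_zero {n K i : ℕ} (hi : K < i) : esymmRatioProd n K i = 0 :=
  Finset.prod_eq_zero (i := K) (Finset.mem_range.2 hi) (by simp [esymmRatio])

theorem esymmRatioProd_le {n K : ℕ} (hL : 52 ≤ Real.log ((n : ℝ) + 1)) (hK : K ≤ n)
    (hKL : (K : ℝ) ≤ 3 / 2 * Real.log ((n : ℝ) + 1)) (i : ℕ) :
    esymmRatioProd n K i ≤ (8 / 5) ^ i := by
  calc esymmRatioProd n K i ≤ ∏ _l ∈ Finset.range i, (8 / 5 : ℝ) := by
        refine Finset.prod_le_prod (fun _ _ => esymmRatio_nonneg _ _) fun l _ => ?_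
        refine (esymmRatio_bounds hL (by omega) (le_trans ?_ hKL)).1
        exact_mod_cast Nat.sub_le K l
    _ = _ := by rw [Finset.prod_const, Finset.card_range]

theorem abs_esymmRatio_sub_le {n K : ℕ} (hL : 52 ≤ Real.log ((n : ℝ) + 1)) (hK : K ≤ n)
    (hKL : (K : ℝ) ≤ 3 / 2 * Real.log ((n : ℝ) + 1)) (i : ℕ) :
    |esymmRatio n (K - i) - K / Real.log ((n : ℝ) + 1)| ≤
      (6 + i) / Real.log ((n : ℝ) + 1) := by
  set L := Real.log ((n : ℝ) + 1)
  have hsub : ((K - i : ℕ) : ℝ) ≤ K := by exact_mod_cast Nat.sub_le K i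
  have h1 := (esymmRatio_bounds hL (m := K - i) (by omega) (hsub.trans hKL)).2
  have h2 : |((K - i : ℕ) : ℝ) / L - K / L| ≤ i / L := by
    rw [← sub_div, abs_div, abs_of_pos (by linarith : 0 < L)]
    gcongr
    rw [abs_le]
    have : (K : ℝ) ≤ ((K - i : ℕ) : ℝ) + i := by exact_mod_cast (by omega : K ≤ K - i + i)
    constructor <;> linarith [(Nat.cast_nonneg i : (0 : ℝ) ≤ i)]
  have h3 : 4 * ((K - i : ℕ) : ℝ) / L ^ 2 ≤ 6 / L := by
    rw [div_le_div_iff₀ (by positivity) (by linarith)]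
    nlinarith
  calc |esymmRatio n (K - i) - K / L|
      ≤ |esymmRatio n (K - i) - ((K - i : ℕ) : ℝ) / L| + |((K - i : ℕ) : ℝ) / L - K / L| :=
        abs_sub_le _ _ _
    _ ≤ 6 / L + i / L := by linarith
    _ = _ := by ring

/-- The first factor of the telescoping product is itself `O(K / log n)`, which is what makes the
error terms of all the later factors acceptable. -/
theorem abs_esymmRatioProd_sub_pow_le {n K : ℕ} (hL : 52 ≤ Real.log ((n : ℝ) + 1)) (hK : K ≤ n)
    (hKL : (K : ℝ) ≤ 3 / 2 * Real.log ((n : ℝ) + 1)) (i : ℕ) :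
    |esymmRatioProd n K i - (K / Real.log ((n : ℝ) + 1)) ^ i| ≤
      8 * i ^ 2 * (8 / 5) ^ i * (K / Real.log ((n : ℝ) + 1) ^ 2) := by
  set L := Real.log ((n : ℝ) + 1) with hLdef
  have hLpos : 0 < L := by linarith
  set r : ℝ := K / L with hr
  have hr0 : 0 ≤ r := by positivity
  have hr1 : r ≤ 8 / 5 := by rw [hr, div_le_iff₀ hLpos]; linarith
  have hx0 : |esymmRatio n K - r| ≤ 4 * (K / L ^ 2) := by
    have := (esymmRatio_bounds hL hK hKL).2
    rwa [mul_div_assoc] at this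
  have hrL : r / L = K / L ^ 2 := by rw [hr]; field_simp
  have hx0' : esymmRatio n K ≤ 2 * r := by
    have h1 := (abs_le.1 hx0).2
    rw [← hrL] at h1
    have : r / L ≤ r / 52 := by gcongr
    linarith
  -- For `i ≥ 1` the factor `esymmRatio n K` is split off from the product.
  have hstep : ∀ i : ℕ, esymmRatioProd n K i * |esymmRatio n (K - i) - r| ≤
      (12 + 2 * i) * (8 / 5) ^ i * (K / L ^ 2) := by
    intro i
    cases i with
    | zero =>
      have : (0 : ℝ) ≤ K / L ^ 2 := by positivity
      simp [esymmRatioProd]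
      linarith
    | succ i =>
      have h1 : esymmRatioProd n K (i + 1) ≤ (8 / 5) ^ i * (2 * r) := by
        rw [esymmRatioProd, Finset.prod_range_succ']
        refine mul_le_mul ?_ (by simpa using hx0') (esymmRatio_nonneg _ _) (by positivity)
        calc _ ≤ ∏ _l ∈ Finset.range i, (8 / 5 : ℝ) := by
              refine Finset.prod_le_prod (fun _ _ => esymmRatio_nonneg _ _) fun l _ => ?_
              refine (esymmRatio_bounds hL (by omega) (le_trans ?_ hKL)).1
              exact_mod_cast Nat.sub_le K (l + 1)
          _ = _ := by rw [Finset.prod_const, Finset.card_range]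
      have h2 := abs_esymmRatio_sub_le hL hK hKL (i + 1)
      rw [← hLdef, ← hr] at h2
      calc esymmRatioProd n K (i + 1) * |esymmRatio n (K - (i + 1)) - r|
          ≤ ((8 / 5) ^ i * (2 * r)) * ((6 + (i + 1 : ℕ)) / L) :=
            mul_le_mul h1 h2 (abs_nonneg _) (by positivity)
        _ = (12 + 2 * (i + 1 : ℕ)) * (8 / 5) ^ i * (r / L) := by ring
        _ ≤ (12 + 2 * (i + 1 : ℕ)) * (8 / 5) ^ (i + 1) * (r / L) := by
            gcongr <;> norm_num
        _ = _ := by rw [hrL]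
  induction i with
  | zero => simp [esymmRatioProd]
  | succ i ih =>
    have hdecomp : esymmRatioProd n K (i + 1) - r ^ (i + 1) =
        esymmRatioProd n K i * (esymmRatio n (K - i) - r) +
          r * (esymmRatioProd n K i - r ^ i) := by
      rw [esymmRatioProd_succ]; ring
    calc |esymmRatioProd n K (i + 1) - r ^ (i + 1)|
        ≤ esymmRatioProd n K i * |esymmRatio n (K - i) - r| +
            r * |esymmRatioProd n K i - r ^ i| := by
          rw [hdecomp]
          refine (abs_add_le _ _).trans_eq ?_
          rw [abs_mul, abs_mul, abs_of_nonneg (esymmRatioProd_nonneg _ _ _), abs_of_nonneg hr0]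
      _ ≤ (12 + 2 * i) * (8 / 5) ^ i * (K / L ^ 2) +
            8 / 5 * (8 * i ^ 2 * (8 / 5) ^ i * (K / L ^ 2)) := by
          exact add_le_add (hstep i) (by gcongr)
      _ = (12 + 2 * i + 64 / 5 * i ^ 2) * ((8 / 5) ^ i * (K / L ^ 2)) := by ring
      _ ≤ (64 / 5 * (i + 1) ^ 2) * ((8 / 5) ^ i * (K / L ^ 2)) := by
          gcongr; nlinarith [(Nat.cast_nonneg i : (0 : ℝ) ≤ i)]
      _ = _ := by push_cast; ring

/-! ### Comparison of cycle probabilities -/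

/-- The ratio `ℙ(K(π_{n-j}) = k - i) / ℙ(K(π_n) = k)`, read as `0` when `n - j` or `k - i` is
negative. -/
noncomputable def cycleRatio (n k j i : ℕ) : ℝ :=
  if j ≤ n ∧ i ≤ k then probCycles (n - j) (k - i) / probCycles n k else 0

theorem probCycles_pos {n k : ℕ} (hk : 1 ≤ k) (hkn : k ≤ n) : 0 < probCycles n k := by
  obtain ⟨N, rfl⟩ : ∃ N, n = N + 1 := ⟨n - 1, by omega⟩
  obtain ⟨K, rfl⟩ : ∃ K, k = K + 1 := ⟨k - 1, by omega⟩
  rw [probCycles_succ_succ]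
  have := harmonicEsymm_pos (n := N) (m := K) (by omega)
  positivity

/-- Replacing `n - j` by `n` costs an error `O(j² / n)`: the ratio is `O(j / n)` off for `j ≤ n / 2`
and trivially `O(n)` for larger `j`. -/
theorem abs_cycleRatio_sub_esymmRatioProd_le {n K : ℕ}
    (hL : 52 ≤ Real.log ((n : ℝ) + 1)) (hK : K ≤ n)
    (hKL : (K : ℝ) ≤ 3 / 2 * Real.log ((n : ℝ) + 1)) {j : ℕ} (hj : 1 ≤ j) (i : ℕ) :
    |cycleRatio (n + 1) (K + 1) j i - esymmRatioProd n K i| ≤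
      11 * (8 / 5) ^ i * (j ^ 2 / ((n : ℝ) + 1)) := by
  have hX0 := esymmRatioProd_nonneg n K i
  have hX := esymmRatioProd_le hL hK hKL i
  have hN : (0 : ℝ) < (n : ℝ) + 1 := by positivity
  have hj' : (1 : ℝ) ≤ j := by exact_mod_cast hj
  have heK := harmonicEsymm_pos hK
  -- When `2 j > n`, it suffices to bound the ratio itself by `O(n)`.
  have hlarge : (n : ℝ) + 1 < 2 * j → 0 ≤ cycleRatio (n + 1) (K + 1) j i →
      cycleRatio (n + 1) (K + 1) j i ≤ ((n : ℝ) + 1) * (8 / 5) ^ i →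
      |cycleRatio (n + 1) (K + 1) j i - esymmRatioProd n K i| ≤
        11 * (8 / 5) ^ i * (j ^ 2 / ((n : ℝ) + 1)) := by
    intro h1 h2 h3
    have h4 : (n : ℝ) + 1 ≤ 4 * (j ^ 2 / ((n : ℝ) + 1)) := by
      rw [← mul_div_assoc, le_div_iff₀ hN]; nlinarith
    have h6 : ((n : ℝ) + 1) * (8 / 5) ^ i ≤ 11 * (8 / 5) ^ i * (j ^ 2 / ((n : ℝ) + 1)) := by
      nlinarith
    have h7 : (8 / 5 : ℝ) ^ i ≤ ((n : ℝ) + 1) * (8 / 5) ^ i := by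
      nlinarith [(Nat.cast_nonneg n : (0 : ℝ) ≤ n)]
    rw [abs_le]
    constructor <;> linarith
  rcases lt_trichotomy j (n + 1) with hlt | heq | hgt
  · obtain ⟨a, rfl⟩ : ∃ a, n = a + j := ⟨n - j, by omega⟩
    rcases le_or_gt i K with hiK | hiK
    · have hXe := esymmRatioProd_eq hK hiK
      have ha : (0 : ℝ) < (a : ℝ) + 1 := by positivity
      have hQ : cycleRatio (a + j + 1) (K + 1) j i =
          ((a : ℝ) + j + 1) / ((a : ℝ) + 1) *
            (harmonicEsymm a (K - i) / harmonicEsymm (a + j) K) := by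
        rw [cycleRatio, if_pos ⟨by omega, by omega⟩, show a + j + 1 - j = a + 1 by omega,
          show K + 1 - i = K - i + 1 by omega, probCycles_succ_succ, probCycles_succ_succ]
        push_cast
        field_simp
      have hQX : harmonicEsymm a (K - i) / harmonicEsymm (a + j) K ≤
          esymmRatioProd (a + j) K i := by
        rw [hXe]
        gcongr
        exact harmonicEsymm_mono (Nat.le_add_right a j) _
      have hQ0 : 0 ≤ harmonicEsymm a (K - i) / harmonicEsymm (a + j) K :=
        div_nonneg (harmonicEsymm_nonneg _ _) heK.le
      push_cast at hN ⊢
      by_cases hc : 2 * (j : ℝ) ≤ (a : ℝ) + j + 1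
      · have hratio : ((a : ℝ) + j + 1) / ((a : ℝ) + 1) ≤ 2 := by
          rw [div_le_iff₀ ha]; linarith
        have hratio' : ((a : ℝ) + j + 1) / ((a : ℝ) + 1) = 1 + j / ((a : ℝ) + 1) := by
          field_simp; ring
        have hjle : (j : ℝ) / ((a : ℝ) + 1) ≤ 2 * (j ^ 2 / ((a : ℝ) + j + 1)) := by
          rw [← mul_div_assoc, div_le_div_iff₀ ha hN]
          have : (a : ℝ) + j + 1 ≤ 2 * j * (a + 1) := by nlinarith
          nlinarith
        have hlow : esymmRatioProd (a + j) K i -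
            j / ((a : ℝ) + 1) * esymmRatioProd (a + j) K (i + 1) ≤
            harmonicEsymm a (K - i) / harmonicEsymm (a + j) K := by
          rcases hiK.lt_or_eq with hlt' | rfl
          · rw [hXe, esymmRatioProd_eq hK (by omega : i + 1 ≤ K)]
            obtain ⟨s, hs⟩ : ∃ s, K - i = s + 1 := ⟨K - i - 1, by omega⟩
            rw [hs, show K - (i + 1) = s by omega, ← mul_div_assoc, ← sub_div]
            gcongr
            linarith [harmonicEsymm_add_le a j s]
          · rw [hXe, esymmRatioProd_eq_zero (Nat.lt_succ_self _)]
            simp [harmonicEsymm_zero_right]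
        have hX1 := esymmRatioProd_le hL hK hKL (i + 1)
        have hX10 := esymmRatioProd_nonneg (a + j) K (i + 1)
        have hp : (0 : ℝ) < (8 / 5) ^ i := by positivity
        rw [pow_succ] at hX1
        set T := harmonicEsymm a (K - i) / harmonicEsymm (a + j) K
        set u := (j : ℝ) / ((a : ℝ) + 1) with hu
        have hu0 : 0 ≤ u := by positivity
        set v := (j : ℝ) ^ 2 / ((a : ℝ) + j + 1)
        rw [hQ, hratio'] at *
        have b1 : u * T ≤ 2 * v * (8 / 5) ^ i :=
          mul_le_mul hjle (hQX.trans hX) hQ0 (by positivity)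
        have b2 : u * esymmRatioProd (a + j) K (i + 1) ≤ 2 * v * ((8 / 5) ^ i * (8 / 5)) :=
          mul_le_mul hjle hX1 hX10 (by positivity)
        rw [abs_le]
        constructor <;> nlinarith
      · have hfac : ((a : ℝ) + j + 1) / ((a : ℝ) + 1) ≤ (a : ℝ) + j + 1 :=
          div_le_self hN.le (by linarith [(Nat.cast_nonneg a : (0 : ℝ) ≤ a)])
        push_cast at hlarge
        refine hlarge (not_le.1 hc) ?_ ?_
        · rw [hQ]; positivity
        · rw [hQ]
          exact mul_le_mul hfac (hQX.trans hX) hQ0 hN.le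
    · have hQ : cycleRatio (a + j + 1) (K + 1) j i = 0 := by
        rw [cycleRatio]
        split_ifs with h
        · rw [show a + j + 1 - j = a + 1 by omega, show K + 1 - i = 0 by omega, probCycles_eq]
          simp
        · rfl
      rw [hQ, esymmRatioProd_eq_zero hiK]
      simp only [sub_self, abs_zero]
      positivity
  · subst heq
    refine hlarge (by push_cast; linarith [(Nat.cast_nonneg n : (0 : ℝ) ≤ n)]) ?_ ?_
    · rw [cycleRatio]
      split_ifs
      · rw [probCycles_eq, probCycles_eq]; positivity
      · rfl
    · rw [cycleRatio]
      split_ifs with h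
      · rcases h.2.lt_or_eq with h' | rfl
        · rw [Nat.sub_self, show K + 1 - i = (K - i) + 1 by omega, probCycles_eq]
          simp
          positivity
        · rw [Nat.sub_self, Nat.sub_self, probCycles_succ_succ, probCycles_eq]
          have h1 := esymmRatioProd_eq hK le_rfl
          have h2 := esymmRatioProd_le hL hK hKL K
          have hp : (0 : ℝ) < (8 / 5) ^ K := by positivity
          rw [Nat.sub_self, harmonicEsymm_zero_right] at h1
          calc (((0 : ℕ).stirlingFirst 0 : ℝ) / ((0 : ℕ).factorial : ℝ)) /
                (harmonicEsymm n K / ((n : ℝ) + 1))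
              = ((n : ℝ) + 1) * esymmRatioProd n K K := by
                rw [h1]; simp; field_simp
            _ ≤ ((n : ℝ) + 1) * (8 / 5) ^ (K + 1) := by
                gcongr
                rw [pow_succ]; linarith
      · positivity
  · have hQ : cycleRatio (n + 1) (K + 1) j i = 0 := by
      rw [cycleRatio, if_neg]; omega
    have : (n : ℝ) + 1 < j := by exact_mod_cast hgt
    refine hlarge (by linarith) hQ.ge ?_
    rw [hQ]; positivity

theorem log_sq_le_four_mul {x : ℝ} (hx : 1 ≤ x) : Real.log x ^ 2 ≤ 4 * x := by
  have h1 : Real.log (Real.sqrt x) ≤ Real.sqrt x := Real.log_le_self (Real.sqrt_nonneg x)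
  rw [Real.log_sqrt (by linarith)] at h1
  have h2 := Real.sq_sqrt (show 0 ≤ x by linarith)
  have h3 := Real.log_nonneg hx
  nlinarith

theorem rParam_nonneg {n k : ℕ} (hk : 1 ≤ k) : 0 ≤ rParam n k := by
  rw [rParam]
  have : (1 : ℝ) ≤ k := by exact_mod_cast hk
  have := Real.log_natCast_nonneg n
  apply div_nonneg <;> linarith

theorem probCycles_le_one (n k : ℕ) : probCycles n k ≤ 1 := by
  rw [probCycles]
  refine div_le_one_of_le₀ ?_ (Nat.cast_nonneg _)
  have := Set.ncard_le_card {π : Equiv.Perm (Fin n) | numCycles π = k}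
  exact_mod_cast this

theorem inv_factorial_le_probCycles {n k : ℕ} (hk : 1 ≤ k) (hkn : k ≤ n) :
    1 / (n.factorial : ℝ) ≤ probCycles n k := by
  have h := probCycles_pos hk hkn
  rw [probCycles_eq] at h ⊢
  gcongr
  have : (0 : ℝ) < (n.stirlingFirst k : ℝ) := by
    by_contra hn
    have : (n.stirlingFirst k : ℝ) = 0 := le_antisymm (not_lt.1 hn) (Nat.cast_nonneg _)
    simp [this] at h
  exact_mod_cast this

/-- Lowering `n` by `j` and `k` by `i` multiplies the cycle probability by about `r ^ i`. -/
theorem exists_abs_cycleRatio_sub_pow_le :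
    ∃ C : ℝ, 0 < C ∧ ∀ n k j i : ℕ, 2 ≤ n → 1 ≤ k → k ≤ n → rParam n k ≤ 3 / 2 → 1 ≤ j →
      |cycleRatio n k j i - rParam n k ^ i| ≤
        C * (9 / 5) ^ i * j ^ 2 * (k / Real.log n ^ 2) := by
  obtain ⟨C₁, hC₁⟩ : ∃ C₁ : ℝ, ∀ i : ℕ, (i : ℝ) ^ 2 * (8 / 9) ^ i ≤ C₁ := by
    obtain ⟨C₁, h⟩ := (tendsto_pow_const_mul_const_pow_of_abs_lt_one 2
      (r := (8 / 9 : ℝ)) (by rw [abs_of_pos] <;> norm_num)).bddAbove_range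
    exact ⟨C₁, fun i => h ⟨i, rfl⟩⟩
  have hC₁0 : 0 ≤ C₁ := by simpa using hC₁ 0
  set M : ℝ := (Nat.factorial ⌈Real.exp 52⌉₊ : ℝ)
  have hM : 0 ≤ M := by positivity
  refine ⟨(44 + 8 * C₁) + (M + 1) * 52 ^ 2, by positivity, ?_⟩
  intro n k j i hn hk hkn hr hj
  have hn' : (2 : ℝ) ≤ n := by exact_mod_cast hn
  have hk' : (1 : ℝ) ≤ k := by exact_mod_cast hk
  have hj' : (1 : ℝ) ≤ j := by exact_mod_cast hj
  have hj2 : (1 : ℝ) ≤ (j : ℝ) ^ 2 := one_le_pow₀ hj'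
  have hLpos : 0 < Real.log n := Real.log_pos (by linarith)
  have hr0 := rParam_nonneg (n := n) hk
  set T : ℝ := (9 / 5) ^ i * j ^ 2 * (k / Real.log n ^ 2) with hT
  have hT0 : 0 ≤ T := by positivity
  have hgoal : ∀ c : ℝ, c * (9 / 5) ^ i * j ^ 2 * (k / Real.log n ^ 2) = c * T := by
    intro c; rw [hT]; ring
  rw [hgoal]
  -- For `log n < 52` there are only finitely many `n`, and trivial bounds suffice.
  rcases le_or_gt 52 (Real.log n) with hL | hL
  · obtain ⟨N, rfl⟩ : ∃ N, n = N + 1 := ⟨n - 1, by omega⟩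
    obtain ⟨K, rfl⟩ : ∃ K, k = K + 1 := ⟨k - 1, by omega⟩
    have hrK : rParam (N + 1) (K + 1) = K / Real.log ((N : ℝ) + 1) := by
      rw [rParam]; push_cast; ring_nf
    rw [hrK] at hr ⊢
    push_cast at hL hLpos hT
    set L := Real.log ((N : ℝ) + 1) with hLdef
    have hKL : (K : ℝ) ≤ 3 / 2 * L := by rwa [div_le_iff₀ hLpos] at hr
    have h1 := abs_cycleRatio_sub_esymmRatioProd_le hL (by omega : K ≤ N) hKL hj i
    have h2 := abs_esymmRatioProd_sub_pow_le hL (by omega : K ≤ N) hKL i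
    have h3 : (1 : ℝ) / ((N : ℝ) + 1) ≤ 4 * ((K + 1) / L ^ 2) := by
      have := log_sq_le_four_mul (x := (N : ℝ) + 1) (by linarith [(Nat.cast_nonneg N : (0:ℝ) ≤ N)])
      rw [← mul_div_assoc, div_le_div_iff₀ (by positivity) (by positivity)]
      nlinarith [(Nat.cast_nonneg K : (0 : ℝ) ≤ K)]
    have hpow : (8 / 5 : ℝ) ^ i ≤ (9 / 5) ^ i := by gcongr; norm_num
    have hpow2 : (i : ℝ) ^ 2 * (8 / 5) ^ i ≤ C₁ * (9 / 5) ^ i := by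
      have : (8 / 5 : ℝ) ^ i = (8 / 9) ^ i * (9 / 5) ^ i := by
        rw [← mul_pow]; norm_num
      rw [this, ← mul_assoc]
      gcongr
      exact hC₁ i
    calc _ ≤ |cycleRatio (N + 1) (K + 1) j i - esymmRatioProd N K i| +
          |esymmRatioProd N K i - (K / L) ^ i| := abs_sub_le _ _ _
      _ ≤ 11 * (8 / 5) ^ i * (j ^ 2 / ((N : ℝ) + 1)) +
          8 * i ^ 2 * (8 / 5) ^ i * (K / L ^ 2) := add_le_add h1 h2
      _ = 11 * (8 / 5) ^ i * j ^ 2 * (1 / ((N : ℝ) + 1)) +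
          8 * (i ^ 2 * (8 / 5) ^ i) * 1 * (K / L ^ 2) := by ring
      _ ≤ 11 * (9 / 5) ^ i * j ^ 2 * (4 * ((K + 1) / L ^ 2)) +
          8 * (C₁ * (9 / 5) ^ i) * j ^ 2 * ((K + 1) / L ^ 2) := by
          gcongr
          linarith
      _ = (44 + 8 * C₁) * T := by rw [hT]; ring
      _ ≤ _ := by
          refine mul_le_mul_of_nonneg_right ?_ hT0
          linarith [mul_nonneg (by linarith : 0 ≤ M + 1) (by norm_num : (0 : ℝ) ≤ 52 ^ 2)]
  · have hnM : (n.factorial : ℝ) ≤ M := by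
      have : n ≤ ⌈Real.exp 52⌉₊ := by
        have h1 : (n : ℝ) < Real.exp 52 := by rwa [← Real.log_lt_iff_lt_exp (by linarith)]
        exact_mod_cast h1.le.trans (Nat.le_ceil _)
      exact Nat.cast_le.2 (Nat.factorial_le this)
    have hQ0 : 0 ≤ cycleRatio n k j i := by
      rw [cycleRatio]
      split_ifs
      · rw [probCycles_eq, probCycles_eq]; positivity
      · rfl
    have hQ : cycleRatio n k j i ≤ M := by
      rw [cycleRatio]
      split_ifs
      · rw [div_le_iff₀ (probCycles_pos hk hkn)]
        have h1 := inv_factorial_le_probCycles hk hkn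
        rw [div_le_iff₀ (by positivity)] at h1
        have := probCycles_le_one (n - j) (k - i)
        nlinarith [probCycles_pos hk hkn]
      · exact hM
    have hri : rParam n k ^ i ≤ (9 / 5) ^ i := by gcongr; linarith
    have hri0 : 0 ≤ rParam n k ^ i := by positivity
    have h95 : (1 : ℝ) ≤ (9 / 5) ^ i := one_le_pow₀ (by norm_num)
    have hkey : (9 / 5 : ℝ) ^ i ≤ 52 ^ 2 * T := by
      have h1 : 1 ≤ (52 : ℝ) ^ 2 * (k / Real.log n ^ 2) := by
        rw [← mul_div_assoc, le_div_iff₀ (by positivity)]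
        nlinarith
      have h2 : (1 : ℝ) ≤ (j : ℝ) ^ 2 * ((52 : ℝ) ^ 2 * (k / Real.log n ^ 2)) := by
        nlinarith
      calc (9 / 5 : ℝ) ^ i = (9 / 5) ^ i * 1 := by ring
        _ ≤ (9 / 5) ^ i * ((j : ℝ) ^ 2 * ((52 : ℝ) ^ 2 * (k / Real.log n ^ 2))) := by gcongr
        _ = _ := by rw [hT]; ring
    calc |cycleRatio n k j i - rParam n k ^ i| ≤ (M + 1) * (9 / 5) ^ i := by
          rw [abs_le]; constructor <;> nlinarith
      _ ≤ (M + 1) * (52 ^ 2 * T) := by gcongr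
      _ ≤ _ := by
          have : 0 ≤ (44 + 8 * C₁) * T := by positivity
          linarith

/-! ### Weighted `ℓ¹` norm of a polynomial -/

/-- The weighted `ℓ¹` norm `∑ |p_i| ρ ^ i` of a real polynomial. -/
noncomputable def weightedNorm (ρ : ℝ) (p : ℝ[X]) : ℝ := p.sum fun i a => |a| * ρ ^ i

section WeightedNorm

variable {ρ : ℝ}

theorem weightedNorm_eq_sum_range (p : ℝ[X]) {N : ℕ} (h : p.natDegree < N) :
    weightedNorm ρ p = ∑ i ∈ Finset.range N, |p.coeff i| * ρ ^ i :=
  p.sum_over_range' (by simp) N h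

theorem weightedNorm_nonneg (hρ : 0 ≤ ρ) (p : ℝ[X]) : 0 ≤ weightedNorm ρ p :=
  Finset.sum_nonneg fun _ _ => by positivity

theorem weightedNorm_zero : weightedNorm ρ 0 = 0 := by simp [weightedNorm]

theorem weightedNorm_monomial (i : ℕ) (a : ℝ) : weightedNorm ρ (monomial i a) = |a| * ρ ^ i := by
  simp [weightedNorm, sum_monomial_index]

theorem weightedNorm_add_le (hρ : 0 ≤ ρ) (p r : ℝ[X]) :
    weightedNorm ρ (p + r) ≤ weightedNorm ρ p + weightedNorm ρ r := by
  set N := max p.natDegree r.natDegree + 1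
  have h3 : (p + r).natDegree < N := Nat.lt_succ_of_le (natDegree_add_le p r)
  rw [weightedNorm_eq_sum_range p (N := N) (by omega),
    weightedNorm_eq_sum_range r (N := N) (by omega), weightedNorm_eq_sum_range _ h3,
    ← Finset.sum_add_distrib]
  refine Finset.sum_le_sum fun i _ => ?_
  rw [coeff_add, ← add_mul]
  gcongr
  exact abs_add_le _ _

theorem weightedNorm_sum_le (hρ : 0 ≤ ρ) {ι : Type*} (s : Finset ι) (f : ι → ℝ[X]) :
    weightedNorm ρ (∑ i ∈ s, f i) ≤ ∑ i ∈ s, weightedNorm ρ (f i) :=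
  Finset.le_sum_of_subadditive _ weightedNorm_zero.le (weightedNorm_add_le hρ) s f

theorem weightedNorm_mul_le (hρ : 0 ≤ ρ) (p r : ℝ[X]) :
    weightedNorm ρ (p * r) ≤ weightedNorm ρ p * weightedNorm ρ r := by
  rw [mul_eq_sum_sum]
  refine (weightedNorm_sum_le hρ _ _).trans ?_
  rw [weightedNorm, weightedNorm, sum_def, sum_def, Finset.sum_mul_sum]
  refine Finset.sum_le_sum fun i _ => ?_
  rw [sum_def]
  refine (weightedNorm_sum_le hρ _ _).trans (Finset.sum_le_sum fun j _ => ?_)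
  rw [weightedNorm_monomial, abs_mul, pow_add]
  exact le_of_eq (by ring)

theorem weightedNorm_C_mul (a : ℝ) (p : ℝ[X]) :
    weightedNorm ρ (C a * p) = |a| * weightedNorm ρ p := by
  rw [weightedNorm_eq_sum_range p (Nat.lt_succ_self _),
    weightedNorm_eq_sum_range _ (Nat.lt_succ_of_le (natDegree_C_mul_le a p)), Finset.mul_sum]
  refine Finset.sum_congr rfl fun i _ => ?_
  rw [coeff_C_mul, abs_mul, mul_assoc]

theorem abs_eval_le_weightedNorm {x : ℝ} (hx : 0 ≤ x) (hxρ : x ≤ ρ) (p : ℝ[X]) :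
    |p.eval x| ≤ weightedNorm ρ p := by
  rw [eval_eq_sum, weightedNorm, sum_def, sum_def]
  refine (Finset.abs_sum_le_sum_abs _ _).trans (Finset.sum_le_sum fun i _ => ?_)
  rw [abs_mul, abs_pow, abs_of_nonneg hx]
  gcongr

theorem weightedNorm_X_pow_sub_X_le (hρ : 0 ≤ ρ) (m : ℕ) :
    weightedNorm ρ ((X : ℝ[X]) ^ m - X) ≤ ρ ^ m + ρ := by
  have h : (X : ℝ[X]) ^ m - X = monomial m 1 + monomial 1 (-1) := by
    simp [← C_mul_X_pow_eq_monomial, sub_eq_add_neg]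
  rw [h]
  refine (weightedNorm_add_le hρ _ _).trans ?_
  rw [weightedNorm_monomial, weightedNorm_monomial]
  simp

end WeightedNorm

/-! ### The generating series and their quotient -/

/-- The generating polynomial `∑ ℙ(K(π_n) = k) z ^ k` of the number of cycles. -/
noncomputable def cyclePoly (n : ℕ) : ℝ[X] :=
  ∑ k ∈ Finset.range (n + 1), C (probCycles n k) * X ^ k

theorem coeff_cyclePoly (n k : ℕ) : (cyclePoly n).coeff k = probCycles n k := by
  rw [cyclePoly, finsetSum_coeff]
  simp only [coeff_C_mul, coeff_X_pow, mul_ite, mul_one, mul_zero]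
  rw [Finset.sum_ite_eq]
  split_ifs with h
  · rfl
  · rw [probCycles_eq, Nat.stirlingFirst_eq_zero_of_lt (by simpa using h)]
    simp

theorem cyclePoly_zero : cyclePoly 0 = 1 := by
  simp [cyclePoly, probCycles_eq]

theorem succ_mul_cyclePoly (n : ℕ) :
    ((n : ℝ[X]) + 1) * cyclePoly (n + 1) = (n : ℝ[X]) * cyclePoly n + X * cyclePoly n := by
  ext k
  have h1 : ((n : ℝ[X]) + 1) = C ((n : ℝ) + 1) := by simp
  have h2 : (n : ℝ[X]) = C (n : ℝ) := by simp
  rw [h1, h2, coeff_add, coeff_C_mul, coeff_C_mul, coeff_cyclePoly, coeff_cyclePoly]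
  cases k with
  | zero =>
    rw [coeff_X_mul_zero, probCycles_eq, probCycles_eq]
    cases n <;> simp
  | succ k =>
    rw [coeff_X_mul, coeff_cyclePoly, probCycles_eq, probCycles_eq, probCycles_eq,
      Nat.stirlingFirst_succ_succ, Nat.factorial_succ]
    push_cast
    field_simp

theorem cyclePoly_recurrence (n : ℕ) :
    ((n : ℝ[X]) + 1) * cyclePoly (n + 1) =
      ∑ x ∈ Finset.HasAntidiagonal.antidiagonal n, X * cyclePoly x.2 := by
  induction n with
  | zero => rw [succ_mul_cyclePoly]; simp
  | succ n ih =>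
    rw [succ_mul_cyclePoly, Finset.Nat.sum_antidiagonal_succ]
    push_cast
    rw [ih, add_comm]

/-- The generating series `∑ c_n(z) u ^ n = (1 - u) ^ (-z)` of the cycle polynomials. -/
noncomputable def cycleSeries : PowerSeries ℝ[X] := PowerSeries.mk cyclePoly

theorem derivative_cycleSeries :
    PowerSeries.derivative ℝ[X] cycleSeries =
      PowerSeries.mk (fun _ => (X : ℝ[X])) * cycleSeries := by
  ext1 n
  rw [PowerSeries.coeff_derivative, PowerSeries.coeff_mul, cycleSeries, PowerSeries.coeff_mk,
    mul_comm, cyclePoly_recurrence]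
  simp

/-- If `h = a / f` in a ring of power series, the logarithmic derivative of `h` is the difference of
those of `a` and `f`. -/
theorem derivative_of_mul_eq {R : Type*} [CommRing R] {f g h a β γ : PowerSeries R}
    (hfg : f * g = 1) (hfh : f * h = a) (hf : PowerSeries.derivative R f = β * f)
    (ha : PowerSeries.derivative R a = γ * a) :
    PowerSeries.derivative R h = (γ - β) * h := by
  have e := congrArg (PowerSeries.derivative R) hfh
  rw [Derivation.leibniz, hf, ha, ← hfh] at e
  simp only [smul_eq_mul] at e
  linear_combination g * e + ((γ - β) * h - PowerSeries.derivative R h) * hfg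

section Series

variable (F : Type*) [Field F] [Finite F]

/-- The generating series `∏_P (1 - z (u / q) ^ deg P)⁻¹` of the polynomials
`q ^ (-n) ∑_f z ^ Ω(f)`. -/
noncomputable def omegaSeries : PowerSeries ℝ[X] :=
  PowerSeries.mk fun n => C (((Nat.card F : ℝ) ^ n)⁻¹) * omegaSum F n

/-- The logarithmic derivative in `u` of `omegaSeries`. -/
noncomputable def omegaLogDeriv : PowerSeries ℝ[X] :=
  PowerSeries.mk fun l => C (((Nat.card F : ℝ) ^ (l + 1))⁻¹) * primePowerSum F (l + 1)

theorem sum_Icc_one_eq_sum_antidiagonal {M : Type*} [AddCommMonoid M] (n : ℕ) (f : ℕ → ℕ → M) :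
    ∑ l ∈ Finset.Icc 1 (n + 1), f l (n + 1 - l) =
      ∑ x ∈ Finset.HasAntidiagonal.antidiagonal n, f (x.1 + 1) x.2 := by
  rw [Finset.Nat.sum_antidiagonal_eq_sum_range_succ_mk]
  symm
  refine Finset.sum_bij (fun l _ => l + 1) ?_ ?_ ?_ ?_
  · intro l hl
    simp only [Finset.mem_range, Finset.mem_Icc] at *
    omega
  · intro a _ b _ h
    simpa using h
  · intro b hb
    simp only [Finset.mem_Icc] at hb
    exact ⟨b - 1, by simp only [Finset.mem_range]; omega, by omega⟩
  · intro l hl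
    simp only
    rw [Nat.add_sub_add_right]

theorem derivative_omegaSeries :
    PowerSeries.derivative ℝ[X] (omegaSeries F) = omegaLogDeriv F * omegaSeries F := by
  ext1 n
  have h := omegaSum_recurrence F (n + 1)
  rw [sum_Icc_one_eq_sum_antidiagonal n (fun l m => primePowerSum F l * omegaSum F m)] at h
  rw [PowerSeries.coeff_derivative, PowerSeries.coeff_mul, omegaSeries, omegaLogDeriv,
    PowerSeries.coeff_mk, mul_assoc, mul_comm (omegaSum F (n + 1))]
  push_cast at h
  rw [h, Finset.mul_sum]
  refine Finset.sum_congr rfl fun x hx => ?_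
  rw [Finset.HasAntidiagonal.mem_antidiagonal] at hx
  rw [PowerSeries.coeff_mk, PowerSeries.coeff_mk, ← hx,
    show x.1 + x.2 + 1 = (x.1 + 1) + x.2 by ring, pow_add _ (x.1 + 1) x.2, mul_inv, C_mul]
  ring

theorem omegaSum_zero : omegaSum F 0 = 1 := by
  classical
  have h : monicFinset F 0 = {1} := by
    ext f
    rw [mem_monicFinset, Finset.mem_singleton]
    constructor
    · rintro ⟨h1, h2⟩
      exact h1.natDegree_eq_zero.1 h2
    · rintro rfl
      exact ⟨monic_one, natDegree_one⟩
  simp [omegaSum, h, polyOmega]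

/-- The quotient of the two generating series: a power series in `u` with coefficients polynomials
in `z`, whose value at `u = 1` is `h_q(z)`. -/
noncomputable def quotientSeries : PowerSeries ℝ[X] :=
  omegaSeries F * PowerSeries.invOfUnit cycleSeries 1

theorem cycleSeries_mul_inv : cycleSeries * PowerSeries.invOfUnit cycleSeries 1 = 1 :=
  PowerSeries.mul_invOfUnit _ _ (by
    rw [← PowerSeries.coeff_zero_eq_constantCoeff_apply, cycleSeries, PowerSeries.coeff_mk,
      cyclePoly_zero]; rfl)

theorem cycleSeries_mul_quotientSeries : cycleSeries * quotientSeries F = omegaSeries F := by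
  rw [quotientSeries, mul_left_comm, cycleSeries_mul_inv, mul_one]

/-- The coefficients of `quotientSeries`. -/
noncomputable def quotientPoly (j : ℕ) : ℝ[X] := PowerSeries.coeff j (quotientSeries F)

/-- The coefficients of the logarithmic derivative in `u` of `quotientSeries`. -/
noncomputable def quotientLogPoly (l : ℕ) : ℝ[X] :=
  C (((Nat.card F : ℝ) ^ (l + 1))⁻¹) * primePowerSum F (l + 1) - X

theorem quotientPoly_zero : quotientPoly F 0 = 1 := by
  have h := congrArg (PowerSeries.coeff 0) (cycleSeries_mul_quotientSeries F)
  rw [PowerSeries.coeff_mul, omegaSeries, PowerSeries.coeff_mk, omegaSum_zero] at h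
  simpa [cycleSeries, cyclePoly_zero, quotientPoly] using h

theorem derivative_quotientSeries :
    PowerSeries.derivative ℝ[X] (quotientSeries F) =
      PowerSeries.mk (quotientLogPoly F) * quotientSeries F := by
  have hB : PowerSeries.mk (quotientLogPoly F) =
      omegaLogDeriv F - PowerSeries.mk (fun _ => (X : ℝ[X])) := by
    ext1 n
    simp [quotientLogPoly, omegaLogDeriv]
  rw [hB]
  exact derivative_of_mul_eq cycleSeries_mul_inv (cycleSeries_mul_quotientSeries F)
    derivative_cycleSeries (derivative_omegaSeries F)

theorem quotientPoly_recurrence (n : ℕ) :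
    ((n : ℝ[X]) + 1) * quotientPoly F (n + 1) =
      ∑ x ∈ Finset.HasAntidiagonal.antidiagonal n, quotientLogPoly F x.1 * quotientPoly F x.2 := by
  have h := congrArg (PowerSeries.coeff n) (derivative_quotientSeries F)
  rw [PowerSeries.coeff_derivative, PowerSeries.coeff_mul, mul_comm] at h
  rw [quotientPoly, h]
  simp [quotientPoly]

/-- The number of monic `f` of degree `n` with `k` prime factors is a convolution of cycle
probabilities with the coefficients of the quotient series. -/
theorem probOmega_eq_sum (n k : ℕ) :
    probOmega F n k = ∑ j ∈ Finset.range (n + 1), ∑ i ∈ Finset.range (k + 1),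
      (quotientPoly F j).coeff i * probCycles (n - j) (k - i) := by
  classical
  have h := congrArg (fun s => (PowerSeries.coeff n s).coeff k) (cycleSeries_mul_quotientSeries F)
  rw [mul_comm, PowerSeries.coeff_mul, finsetSum_coeff, omegaSeries, PowerSeries.coeff_mk,
    coeff_C_mul, omegaSum, finsetSum_coeff] at h
  have h1 : probOmega F n k = ((Nat.card F : ℝ) ^ n)⁻¹ *
      ∑ f ∈ monicFinset F n, ((X : ℝ[X]) ^ polyOmega f).coeff k := by
    simp only [coeff_X_pow]
    rw [Finset.sum_boole, probOmega, ncard_monicPolys, div_eq_inv_mul]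
    push_cast
    congr 2
    rw [← Set.ncard_coe_finset]
    congr 1
    ext f
    simp [monicFinset, eq_comm]
  rw [h1, ← h, Finset.Nat.sum_antidiagonal_eq_sum_range_succ_mk]
  refine Finset.sum_congr rfl fun j _ => ?_
  rw [coeff_mul, Finset.Nat.sum_antidiagonal_eq_sum_range_succ_mk]
  refine Finset.sum_congr rfl fun i _ => ?_
  simp only [cycleSeries, PowerSeries.coeff_mk, coeff_cyclePoly]
  rfl

end Series

/-! ### Exponential decay of the quotient series -/

theorem sum_Icc_one_eq_sum_range {M : Type*} [AddCommMonoid M] (N : ℕ) (f : ℕ → M) :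
    ∑ l ∈ Finset.Icc 1 N, f l = ∑ l ∈ Finset.range N, f (l + 1) := by
  induction N with
  | zero => simp
  | succ N ih => rw [Finset.sum_Icc_succ_top (by omega), Finset.sum_range_succ, ih]

section Decay

variable (F : Type*) [Field F] [Finite F]

theorem two_le_natCard : (2 : ℝ) ≤ Nat.card F := by
  exact_mod_cast Finite.one_lt_card (α := F)

theorem eval_one_omegaSum (n : ℕ) : (omegaSum F n).eval 1 = (Nat.card F : ℝ) ^ n := by
  rw [omegaSum, eval_finsetSum]
  simp [card_monicFinset]

/-- The prime polynomial theorem in its exact form, obtained from the recurrence at `z = 1`. -/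
theorem sum_divisorsAntidiagonal_primeFinset {n : ℕ} (hn : 1 ≤ n) :
    ∑ x ∈ n.divisorsAntidiagonal, ((x.1 * (primeFinset F x.1).card : ℕ) : ℝ) =
      (Nat.card F : ℝ) ^ n := by
  have hq : (Nat.card F : ℝ) ≠ 0 := by exact_mod_cast Nat.card_pos.ne'
  set t : ℕ → ℝ := fun l => (primePowerSum F l).eval 1 / (Nat.card F : ℝ) ^ l with ht
  have hsum : ∀ n : ℕ, ∑ l ∈ Finset.Icc 1 n, t l = n := by
    intro n
    have h := congrArg (eval 1) (omegaSum_recurrence F n)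
    rw [eval_mul, eval_natCast, eval_one_omegaSum, eval_finsetSum] at h
    have h2 : (n : ℝ) * (Nat.card F : ℝ) ^ n =
        (∑ l ∈ Finset.Icc 1 n, t l) * (Nat.card F : ℝ) ^ n := by
      rw [h, Finset.sum_mul]
      refine Finset.sum_congr rfl fun l hl => ?_
      rw [eval_mul, eval_one_omegaSum, ht]
      have hl' := (Finset.mem_Icc.1 hl).2
      obtain ⟨s, rfl⟩ := Nat.exists_eq_add_of_le hl'
      rw [Nat.add_sub_cancel_left, pow_add]
      field_simp
    exact (mul_right_cancel₀ (pow_ne_zero _ hq) h2).symm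
  obtain ⟨m, rfl⟩ : ∃ m, n = m + 1 := ⟨n - 1, by omega⟩
  have h1 := hsum (m + 1)
  rw [Finset.sum_Icc_succ_top (by omega), hsum m] at h1
  have h2 : t (m + 1) = 1 := by push_cast at h1; linarith
  rw [ht, div_eq_one_iff_eq (pow_ne_zero _ hq)] at h2
  rw [← h2, primePowerSum, eval_finsetSum]
  simp

theorem mul_card_primeFinset_le {d : ℕ} (hd : 1 ≤ d) :
    (d : ℝ) * (primeFinset F d).card ≤ (Nat.card F : ℝ) ^ d := by
  rw [← sum_divisorsAntidiagonal_primeFinset F hd]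
  have := Finset.single_le_sum (f := fun x : ℕ × ℕ => ((x.1 * (primeFinset F x.1).card : ℕ) : ℝ))
    (s := d.divisorsAntidiagonal) (fun _ _ => Nat.cast_nonneg _) (a := (d, 1))
    (by simp; omega)
  push_cast at this
  simpa using this

/-- By the exact prime polynomial theorem the logarithmic derivative of the quotient only involves
proper prime powers. -/
theorem quotientLogPoly_eq (l : ℕ) :
    quotientLogPoly F l = ∑ x ∈ (l + 1).divisorsAntidiagonal,
      C ((x.1 : ℝ) * (primeFinset F x.1).card / (Nat.card F : ℝ) ^ (l + 1)) * (X ^ x.2 - X) := by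
  have hq : (Nat.card F : ℝ) ≠ 0 := by exact_mod_cast Nat.card_pos.ne'
  have h := sum_divisorsAntidiagonal_primeFinset F (n := l + 1) (by omega)
  have h1 : ∑ x ∈ (l + 1).divisorsAntidiagonal,
      C ((x.1 : ℝ) * (primeFinset F x.1).card / (Nat.card F : ℝ) ^ (l + 1)) * (X : ℝ[X]) = X := by
    rw [← Finset.sum_mul, ← map_sum, ← Finset.sum_div]
    push_cast at h
    rw [h, div_self (pow_ne_zero _ hq), C_1, one_mul]
  simp only [mul_sub]
  rw [Finset.sum_sub_distrib, h1, quotientLogPoly, primePowerSum, Finset.mul_sum]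
  congr 1
  refine Finset.sum_congr rfl fun x _ => ?_
  rw [← mul_assoc, ← C_mul, div_eq_inv_mul]
  push_cast
  rfl

theorem sum_pow_le_inv_one_sub {x : ℝ} (h0 : 0 ≤ x) (h1 : x < 1) (s : Finset ℕ) :
    ∑ i ∈ s, x ^ i ≤ (1 - x)⁻¹ := by
  rw [← tsum_geometric_of_lt_one h0 h1]
  exact (summable_geometric_of_lt_one h0 h1).sum_le_tsum s fun i _ => by positivity

/-- A bound for the weighted norm of `z ^ m - z` that vanishes at `m = 1`. -/
noncomputable def powerWeight (m : ℕ) : ℝ := if m ≤ 1 then 0 else (9 / 5) ^ m + 9 / 5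

theorem powerWeight_nonneg (m : ℕ) : 0 ≤ powerWeight m := by
  rw [powerWeight]; split_ifs <;> positivity

theorem weightedNorm_X_pow_sub_X_le_powerWeight {m : ℕ} (hm : 1 ≤ m) :
    weightedNorm (9 / 5) ((X : ℝ[X]) ^ m - X) ≤ powerWeight m := by
  rw [powerWeight]
  split_ifs with h
  · obtain rfl : m = 1 := by omega
    simp [weightedNorm_zero]
  · exact weightedNorm_X_pow_sub_X_le (by norm_num) m

/-- The constants `ρ = 9 / 5` and `R = 11 / 10` satisfy `R ^ 2 < 2` and `ρ * R < 2`, which makes the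
sum over `d` and `m` converge even for the smallest field, `q = 2`; any larger `q` gains a factor
`O(1 / q)`. -/
theorem primePower_term_le {d m : ℕ} (hd : 1 ≤ d) :
    (d : ℝ) * (primeFinset F d).card / (Nat.card F : ℝ) ^ (d * m) * powerWeight m *
      (11 / 10) ^ (d * m) ≤ 26 / (Nat.card F : ℝ) * (605 / 1000) ^ d * (99 / 100) ^ m := by
  have hq2 := two_le_natCard F
  set q : ℝ := (Nat.card F : ℝ)
  rw [powerWeight]
  split_ifs with hm
  · simp only [mul_zero, zero_mul]; positivity
  obtain ⟨s, rfl⟩ : ∃ s, m = s + 2 := ⟨m - 2, by omega⟩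
  have h1 : (d : ℝ) * (primeFinset F d).card / q ^ (d * (s + 2)) ≤
      2 / q * (1 / 2 ^ (d * (s + 1))) := by
    calc (d : ℝ) * (primeFinset F d).card / q ^ (d * (s + 2)) ≤ q ^ d / q ^ (d * (s + 2)) := by
          gcongr; exact mul_card_primeFinset_le F hd
      _ = 1 / q ^ (d * (s + 1)) := by
          rw [show d * (s + 2) = d + d * (s + 1) by ring, pow_add]
          field_simp
      _ = 1 / q * (1 / q ^ (d * (s + 1) - 1)) := by
          obtain ⟨t, ht⟩ : ∃ t, d * (s + 1) = t + 1 :=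
            ⟨d * (s + 1) - 1, (Nat.sub_add_cancel (Nat.mul_pos hd (Nat.succ_pos s))).symm⟩
          rw [ht, Nat.add_sub_cancel, pow_succ]
          field_simp
      _ ≤ 1 / q * (1 / 2 ^ (d * (s + 1) - 1)) := by gcongr
      _ = _ := by
          obtain ⟨t, ht⟩ : ∃ t, d * (s + 1) = t + 1 :=
            ⟨d * (s + 1) - 1, (Nat.sub_add_cancel (Nat.mul_pos hd (Nat.succ_pos s))).symm⟩
          rw [ht, Nat.add_sub_cancel, pow_succ]
          field_simp
  have h2 : (9 / 5 : ℝ) ^ (s + 2) + 9 / 5 ≤ 2 * (9 / 5) ^ (s + 2) := by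
    have : (1 : ℝ) ≤ (9 / 5) ^ s := one_le_pow₀ (by norm_num)
    rw [pow_add]
    nlinarith
  have h3 : (1 : ℝ) / 2 ^ (d * (s + 1)) * (11 / 10) ^ (d * (s + 2)) ≤
      (605 / 1000) ^ d * (55 / 100) ^ s := by
    calc (1 : ℝ) / 2 ^ (d * (s + 1)) * (11 / 10) ^ (d * (s + 2))
        = (605 / 1000) ^ d * (55 / 100) ^ (d * s) := by
          rw [show (605 / 1000 : ℝ) = 1 / 2 * (11 / 10) ^ 2 by norm_num,
            show (55 / 100 : ℝ) = 1 / 2 * (11 / 10) by norm_num, mul_pow, mul_pow, ← pow_mul,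
            show d * (s + 1) = d * s + d by ring, show d * (s + 2) = d * s + 2 * d by ring,
            pow_add, pow_add]
          simp only [one_div, inv_pow, mul_inv]
          ring
      _ ≤ _ := by
          gcongr ?_ * ?_
          exact pow_le_pow_of_le_one (by norm_num) (by norm_num) (Nat.le_mul_of_pos_left s hd)
  calc (d : ℝ) * (primeFinset F d).card / q ^ (d * (s + 2)) * ((9 / 5) ^ (s + 2) + 9 / 5) *
        (11 / 10) ^ (d * (s + 2))
      ≤ (2 / q * (1 / 2 ^ (d * (s + 1)))) * (2 * (9 / 5) ^ (s + 2)) *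
        (11 / 10) ^ (d * (s + 2)) := by gcongr
    _ = 4 / q * (9 / 5) ^ (s + 2) * (1 / 2 ^ (d * (s + 1)) * (11 / 10) ^ (d * (s + 2))) := by ring
    _ ≤ 4 / q * (9 / 5) ^ (s + 2) * ((605 / 1000) ^ d * (55 / 100) ^ s) := by gcongr
    _ = 4 * (9 / 5) ^ 2 / q * (605 / 1000) ^ d * ((9 / 5) ^ s * (55 / 100) ^ s) := by ring
    _ = 4 * (9 / 5) ^ 2 / q * (605 / 1000) ^ d * (99 / 100) ^ s := by
        rw [← mul_pow]; norm_num
    _ = 4 * (9 / 5) ^ 2 / (99 / 100) ^ 2 / q * (605 / 1000) ^ d * (99 / 100) ^ (s + 2) := by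
        rw [pow_add]; field_simp
    _ ≤ _ := by gcongr; norm_num

/-- The sum over the proper prime powers that controls both the quotient series and the Euler
product; it is `O(1 / q)` since a proper prime power `P ^ m` of degree `l` contributes at most
`q ^ (deg P - l)` with `l - deg P ≥ 1`. -/
theorem sum_primePower_le (N : ℕ) :
    ∑ l ∈ Finset.Icc 1 N, ∑ x ∈ l.divisorsAntidiagonal,
      (x.1 : ℝ) * (primeFinset F x.1).card / (Nat.card F : ℝ) ^ (x.1 * x.2) * powerWeight x.2 *
        (11 / 10) ^ (x.1 * x.2) ≤ 7800 / (Nat.card F : ℝ) := by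
  rw [← sum_Icc_mul_eq_sum_divisorsAntidiagonal N (fun d m =>
    (d : ℝ) * (primeFinset F d).card / (Nat.card F : ℝ) ^ (d * m) * powerWeight m *
        (11 / 10) ^ (d * m))]
  calc _ ≤ ∑ d ∈ Finset.Icc 1 N, ∑ m ∈ Finset.Icc 1 N,
          26 / (Nat.card F : ℝ) * (605 / 1000) ^ d * (99 / 100) ^ m := by
        refine Finset.sum_le_sum fun d hd => Finset.sum_le_sum fun m _ => ?_
        split_ifs
        · exact primePower_term_le F (Finset.mem_Icc.1 hd).1
        · positivity
    _ = 26 / (Nat.card F : ℝ) * ((∑ d ∈ Finset.Icc 1 N, (605 / 1000) ^ d) *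
          ∑ m ∈ Finset.Icc 1 N, (99 / 100) ^ m) := by
        rw [Finset.sum_mul_sum, Finset.mul_sum]
        refine Finset.sum_congr rfl fun d _ => ?_
        rw [Finset.mul_sum]
        refine Finset.sum_congr rfl fun m _ => ?_
        ring
    _ ≤ 26 / (Nat.card F : ℝ) * ((1 - 605 / 1000)⁻¹ * (1 - 99 / 100)⁻¹) := by
        gcongr
        · exact sum_pow_le_inv_one_sub (by norm_num) (by norm_num) _
        · exact sum_pow_le_inv_one_sub (by norm_num) (by norm_num) _
    _ ≤ _ := by
        rw [div_mul_eq_mul_div]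
        gcongr
        norm_num

theorem weightedNorm_quotientLogPoly_le (l : ℕ) :
    weightedNorm (9 / 5) (quotientLogPoly F l) * (11 / 10) ^ (l + 1) ≤
      ∑ x ∈ (l + 1).divisorsAntidiagonal,
        (x.1 : ℝ) * (primeFinset F x.1).card / (Nat.card F : ℝ) ^ (x.1 * x.2) * powerWeight x.2 *
          (11 / 10) ^ (x.1 * x.2) := by
  rw [quotientLogPoly_eq]
  refine (mul_le_mul_of_nonneg_right (weightedNorm_sum_le (by norm_num) _ _)
    (by positivity)).trans ?_
  rw [Finset.sum_mul]
  refine Finset.sum_le_sum fun x hx => ?_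
  obtain ⟨h1, h2⟩ := Nat.mem_divisorsAntidiagonal.1 hx
  rw [h1, weightedNorm_C_mul, abs_of_nonneg (by positivity)]
  gcongr
  refine weightedNorm_X_pow_sub_X_le_powerWeight ?_
  rw [← h1] at h2
  exact Nat.pos_of_ne_zero (right_ne_zero_of_mul h2)

theorem sum_weightedNorm_quotientLogPoly_le (N : ℕ) :
    ∑ l ∈ Finset.range N, weightedNorm (9 / 5) (quotientLogPoly F l) * (11 / 10) ^ (l + 1) ≤
      7800 / (Nat.card F : ℝ) := by
  refine le_trans ?_ (sum_primePower_le F N)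
  refine (Finset.sum_le_sum fun l _ => weightedNorm_quotientLogPoly_le F l).trans_eq ?_
  rw [sum_Icc_one_eq_sum_range]

/-- Nonnegative sequences satisfying the recurrence of an exponential generating series stay
bounded, with a gain of the factor `S` from index `1` on. -/
theorem le_mul_pow_of_recurrence {s t : ℕ → ℝ} {S B : ℝ} (hs : ∀ l, 0 ≤ s l)
    (ht : ∀ j, 0 ≤ t j) (h0 : t 0 ≤ 1) (hB : 1 ≤ B) (hSB : S ≤ B)
    (hS : ∀ N, ∑ l ∈ Finset.range N, s l ≤ S)
    (hrec : ∀ j : ℕ, ((j : ℝ) + 1) * t (j + 1) ≤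
      ∑ x ∈ Finset.HasAntidiagonal.antidiagonal j, s x.1 * t x.2) (j : ℕ) :
    t (j + 1) ≤ S * B ^ ⌈B⌉₊ := by
  have hstep : ∀ (j : ℕ) (E : ℝ), (∀ m ≤ j, t m ≤ E) → 0 ≤ E →
      ((j : ℝ) + 1) * t (j + 1) ≤ S * E := by
    intro j E hE hE0
    calc ((j : ℝ) + 1) * t (j + 1) ≤ ∑ x ∈ Finset.HasAntidiagonal.antidiagonal j, s x.1 * E := by
          refine (hrec j).trans (Finset.sum_le_sum fun x hx => ?_)
          have := Finset.HasAntidiagonal.mem_antidiagonal.1 hx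
          exact mul_le_mul_of_nonneg_left (hE _ (by omega)) (hs _)
      _ = (∑ l ∈ Finset.range (j + 1), s l) * E := by
          rw [Finset.Nat.sum_antidiagonal_eq_sum_range_succ_mk, Finset.sum_mul]
      _ ≤ _ := mul_le_mul_of_nonneg_right (hS _) hE0
  have hmain : ∀ j, ∀ m ≤ j, t m ≤ B ^ min j ⌈B⌉₊ := by
    intro j
    induction j with
    | zero =>
      intro m hm
      obtain rfl : m = 0 := by omega
      simpa using h0
    | succ j ih =>
      have hE : (0 : ℝ) ≤ B ^ min j ⌈B⌉₊ := by positivity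
      have hmono : B ^ min j ⌈B⌉₊ ≤ B ^ min (j + 1) ⌈B⌉₊ := pow_le_pow_right₀ hB (by omega)
      intro m hm
      rcases hm.lt_or_eq with h | rfl
      · exact (ih m (by omega)).trans hmono
      have h1 := hstep j _ ih hE
      have hj : (0 : ℝ) ≤ j := Nat.cast_nonneg j
      rcases le_or_gt ⌈B⌉₊ j with hc | hc
      · have hBj : B ≤ j := (Nat.le_ceil B).trans (by exact_mod_cast hc)
        have h2 : ((j : ℝ) + 1) * t (j + 1) ≤ ((j : ℝ) + 1) * B ^ min j ⌈B⌉₊ :=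
          h1.trans (mul_le_mul_of_nonneg_right (by linarith) hE)
        exact (le_of_mul_le_mul_left h2 (by linarith)).trans hmono
      · rw [min_eq_left (by omega), pow_succ']
        rw [min_eq_left (by omega)] at h1 hE
        have h2 := mul_nonneg hj (ht (j + 1))
        have h3 := mul_le_mul_of_nonneg_right hSB hE
        linarith
  have h1 := hstep j _ (fun m hm => (hmain j m hm).trans
    (pow_le_pow_right₀ hB (min_le_right _ _))) (by positivity)
  have h2 := mul_nonneg (Nat.cast_nonneg j : (0 : ℝ) ≤ j) (ht (j + 1))
  linarith

/-- The coefficients of the quotient series are `O(1 / q)` and decay exponentially, uniformly in the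
field. -/
theorem exists_weightedNorm_quotientPoly_le :
    ∃ D : ℝ, 0 < D ∧ ∀ (F : Type u) [Field F] [Finite F] (j : ℕ), 1 ≤ j →
      weightedNorm (9 / 5) (quotientPoly F j) ≤ D / (Nat.card F : ℝ) * (10 / 11) ^ j := by
  refine ⟨7800 * 7800 ^ ⌈(7800 : ℝ)⌉₊, by positivity, ?_⟩
  intro F _ _ j hj
  obtain ⟨i, rfl⟩ : ∃ i, j = i + 1 := ⟨j - 1, by omega⟩
  have hq1 : (1 : ℝ) ≤ Nat.card F := by exact_mod_cast Nat.card_pos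
  have hnn : ∀ p, 0 ≤ weightedNorm (9 / 5) p := weightedNorm_nonneg (by norm_num)
  have h := le_mul_pow_of_recurrence
    (s := fun l => weightedNorm (9 / 5) (quotientLogPoly F l) * (11 / 10) ^ (l + 1))
    (t := fun j => weightedNorm (9 / 5) (quotientPoly F j) * (11 / 10) ^ j)
    (S := 7800 / (Nat.card F : ℝ)) (B := 7800)
    (fun l => mul_nonneg (hnn _) (by positivity)) (fun j => mul_nonneg (hnn _) (by positivity))
    (by
      have : (1 : ℝ[X]) = monomial 0 1 := by simp
      rw [quotientPoly_zero, this, weightedNorm_monomial]; simp)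
    (by norm_num) (div_le_self (by norm_num) hq1)
    (sum_weightedNorm_quotientLogPoly_le F) (fun j => by
      have h1 : (C ((j : ℝ) + 1)) * quotientPoly F (j + 1) =
          ∑ x ∈ Finset.HasAntidiagonal.antidiagonal j,
            quotientLogPoly F x.1 * quotientPoly F x.2 := by
        have := quotientPoly_recurrence F j
        rw [show ((j : ℝ[X]) + 1) = C ((j : ℝ) + 1) by simp] at this
        exact this
      have h2 := weightedNorm_C_mul (ρ := 9 / 5) ((j : ℝ) + 1) (quotientPoly F (j + 1))
      rw [h1, abs_of_nonneg (by positivity)] at h2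
      rw [← mul_assoc, ← h2]
      refine (mul_le_mul_of_nonneg_right (weightedNorm_sum_le (by norm_num) _ _)
        (by positivity)).trans ?_
      rw [Finset.sum_mul]
      refine Finset.sum_le_sum fun x hx => ?_
      have hx' := Finset.HasAntidiagonal.mem_antidiagonal.1 hx
      refine (mul_le_mul_of_nonneg_right (weightedNorm_mul_le (by norm_num) _ _)
        (by positivity)).trans_eq ?_
      rw [← hx', show x.1 + x.2 + 1 = (x.1 + 1) + x.2 by ring, pow_add _ (x.1 + 1)]
      ring) i
  rw [show (10 / 11 : ℝ) = (11 / 10)⁻¹ by norm_num, inv_pow, ← div_eq_mul_inv,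
    le_div_iff₀ (by positivity)]
  exact h.trans_eq (div_mul_eq_mul_div _ _ _)

end Decay

/-! ### Power series satisfying a first-order differential equation -/

theorem summable_mul_pow_of_abs_le {c : ℕ → ℝ} {A x u : ℝ} (hx : 0 < x)
    (hc : ∀ j, |c j| ≤ A * x ^ j) (hu : x * |u| < 1) :
    Summable fun j => ‖c j * u ^ j‖ := by
  refine Summable.of_nonneg_of_le (fun _ => norm_nonneg _) (fun j => ?_)
    ((summable_geometric_of_lt_one (by positivity) hu).mul_left A)
  rw [norm_mul, norm_pow, Real.norm_eq_abs, Real.norm_eq_abs, mul_pow, ← mul_assoc]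
  gcongr
  exact hc j

theorem hasDerivAt_tsum_mul_pow {c : ℕ → ℝ} {A x ρ u : ℝ} (hx : 0 < x)
    (hc : ∀ j, |c j| ≤ A * x ^ j) (hρ : 0 < ρ) (hxρ : x * ρ < 1) (hu : |u| < ρ) :
    HasDerivAt (fun v => ∑' j, c j * v ^ j) (∑' j : ℕ, ((j : ℝ) + 1) * c (j + 1) * u ^ j) u := by
  have hsum : Summable fun j : ℕ => A * x * ((j : ℝ) + 1) * (x * ρ) ^ j := by
    have h1 := summable_pow_mul_geometric_of_norm_lt_one (R := ℝ) 1 (r := x * ρ)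
      (by rw [Real.norm_eq_abs, abs_of_pos (by positivity)]; exact hxρ)
    have h2 := summable_geometric_of_lt_one (r := x * ρ) (by positivity) hxρ
    refine ((h1.add h2).mul_left (A * x)).congr fun j => ?_
    simp only [pow_one]
    ring
  -- The constant term is split off so that the derivatives carry no truncated exponent.
  have hsplit : ∀ v : ℝ, |v| < ρ →
      ∑' j, c j * v ^ j = c 0 + ∑' j, c (j + 1) * v ^ (j + 1) := by
    intro v hv
    have hv' : x * |v| < 1 := by nlinarith
    rw [(summable_mul_pow_of_abs_le hx hc hv').of_norm.tsum_eq_zero_add]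
    simp
  have hmem : ∀ v : ℝ, v ∈ Metric.ball (0 : ℝ) ρ ↔ |v| < ρ := fun v => by simp
  have hder : HasDerivAt (fun v => ∑' j, c (j + 1) * v ^ (j + 1))
      (∑' j : ℕ, ((j : ℝ) + 1) * c (j + 1) * u ^ j) u := by
    refine hasDerivAt_tsum_of_isPreconnected (t := Metric.ball (0 : ℝ) ρ) (y₀ := (0 : ℝ))
      (g := fun j v => c (j + 1) * v ^ (j + 1))
      (g' := fun j v => ((j : ℝ) + 1) * c (j + 1) * v ^ j) hsum
      Metric.isOpen_ball (convex_ball (0 : ℝ) ρ).isPreconnected ?_ ?_ (by simpa using hρ) ?_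
      ((hmem u).2 hu)
    · intro j y _
      have := (hasDerivAt_pow (j + 1) y).const_mul (c (j + 1))
      rw [Nat.add_sub_cancel] at this
      convert! this using 1
      push_cast
      ring
    · intro j y hy
      have hy' := (hmem y).1 hy
      rw [norm_mul, norm_mul, norm_pow, Real.norm_eq_abs, Real.norm_eq_abs, Real.norm_eq_abs,
        abs_of_nonneg (by positivity : (0 : ℝ) ≤ (j : ℝ) + 1)]
      have hcA := hc (j + 1)
      have hA0 := (abs_nonneg _).trans hcA
      calc ((j : ℝ) + 1) * |c (j + 1)| * |y| ^ j
          ≤ ((j : ℝ) + 1) * (A * x ^ (j + 1)) * ρ ^ j := by gcongr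
        _ = _ := by rw [mul_pow, pow_succ]; ring
    · simp
  refine (hder.const_add (c 0)).congr_of_eventuallyEq ?_
  filter_upwards [Metric.isOpen_ball.mem_nhds ((hmem u).2 hu)] with v hv
  exact hsplit v ((hmem v).1 hv)

/-- If the power series with coefficients `h` has logarithmic derivative the power series with
coefficients `b`, both with radius of convergence larger than `1`, its value at `1` is the
exponential of the integral of the logarithmic derivative over `[0, 1]`. -/
theorem tsum_eq_exp_of_recurrence {h b : ℕ → ℝ} {A : ℝ} (h0 : h 0 = 1)
    (hh : ∀ j, |h j| ≤ A * (10 / 11) ^ j) (hb : ∀ l, |b l| ≤ A * (10 / 11) ^ l)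
    (hrec : ∀ n : ℕ, ((n : ℝ) + 1) * h (n + 1) =
      ∑ x ∈ Finset.HasAntidiagonal.antidiagonal n, b x.1 * h x.2) :
    ∑' j, h j = Real.exp (∑' l : ℕ, b l / ((l : ℝ) + 1)) := by
  have hA : 0 ≤ A := by simpa using (abs_nonneg _).trans (hh 0)
  set c : ℕ → ℝ := fun j => b (j - 1) / (j : ℝ) with hc
  have hcb : ∀ j, |c j| ≤ (11 / 10 * A) * (10 / 11) ^ j := by
    intro j
    cases j with
    | zero => simp [hc]; positivity
    | succ j =>
      rw [hc]
      simp only [Nat.add_sub_cancel]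
      rw [abs_div, Nat.abs_cast, pow_succ]
      have hj : (1 : ℝ) ≤ (j + 1 : ℕ) := by exact_mod_cast Nat.succ_pos j
      refine (div_le_self (abs_nonneg _) hj).trans ((hb j).trans_eq ?_)
      ring
  have hcs : ∀ j : ℕ, ((j : ℝ) + 1) * c (j + 1) = b j := by
    intro j
    simp only [hc, Nat.add_sub_cancel]
    push_cast
    field_simp
  set φ : ℝ → ℝ := fun u => ∑' j, h j * u ^ j with hφ
  set L : ℝ → ℝ := fun u => ∑' j, c j * u ^ j with hL
  have hmem : ∀ v : ℝ, v ∈ Metric.ball (0 : ℝ) (21 / 20) ↔ |v| < 21 / 20 := fun v => by simp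
  have hderiv : ∀ u : ℝ, |u| < 21 / 20 →
      HasDerivAt (fun u => φ u * Real.exp (-L u)) 0 u := by
    intro u hu
    have hu' : 10 / 11 * |u| < 1 := by linarith
    have h1 : HasDerivAt φ _ u := hasDerivAt_tsum_mul_pow (ρ := 21 / 20) (by norm_num) hh
      (by norm_num) (by norm_num) hu
    have h2 : HasDerivAt L _ u := hasDerivAt_tsum_mul_pow (ρ := 21 / 20) (by norm_num) hcb
      (by norm_num) (by norm_num) hu
    have h3 : (∑' j : ℕ, ((j : ℝ) + 1) * h (j + 1) * u ^ j) = (∑' l, b l * u ^ l) * φ u := by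
      rw [hφ, tsum_mul_tsum_eq_tsum_sum_antidiagonal_of_summable_norm
        (summable_mul_pow_of_abs_le (by norm_num) hb hu')
        (summable_mul_pow_of_abs_le (by norm_num) hh hu')]
      refine tsum_congr fun n => ?_
      rw [hrec n, Finset.sum_mul]
      refine Finset.sum_congr rfl fun x hx => ?_
      rw [← Finset.HasAntidiagonal.mem_antidiagonal.1 hx, pow_add]
      ring
    have h4 : (∑' j : ℕ, ((j : ℝ) + 1) * c (j + 1) * u ^ j) = ∑' l, b l * u ^ l :=
      tsum_congr fun j => by rw [hcs]
    rw [h3] at h1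
    rw [h4] at h2
    have h5 := h1.mul h2.neg.exp
    convert! h5 using 1
    ring
  have hconst : φ 1 * Real.exp (-L 1) = φ 0 * Real.exp (-L 0) :=
    Metric.isOpen_ball.is_const_of_deriv_eq_zero (s := Metric.ball (0 : ℝ) (21 / 20))
      (convex_ball (0 : ℝ) (21 / 20)).isPreconnected
      (fun u hu => (hderiv u ((hmem u).1 hu)).differentiableAt.differentiableWithinAt)
      (fun u hu => (hderiv u ((hmem u).1 hu)).deriv)
      ((hmem 1).2 (by norm_num)) ((hmem 0).2 (by norm_num))
  have hφ0 : φ 0 = 1 := by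
    simp only [hφ]
    rw [tsum_eq_single 0 (fun j hj => by simp [hj])]
    simp [h0]
  have hL0 : L 0 = 0 := by
    simp only [hL]
    rw [tsum_eq_single 0 (fun j hj => by simp [hj])]
    simp [hc]
  have hL1 : L 1 = ∑' l : ℕ, b l / ((l : ℝ) + 1) := by
    simp only [hL]
    have hs := (summable_mul_pow_of_abs_le (u := 1) (by norm_num) hcb (by norm_num)).of_norm
    rw [hs.tsum_eq_zero_add]
    simp [hc]
  have hφ1 : φ 1 = ∑' j, h j := by simp [hφ]
  rw [hφ0, hL0, neg_zero, Real.exp_zero, one_mul, Real.exp_neg, ← div_eq_mul_inv,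
    div_eq_one_iff_eq (Real.exp_pos _).ne'] at hconst
  rw [← hφ1, hconst, hL1]

/-! ### The Euler product -/

section EulerProduct

variable (F : Type*) [Field F] [Finite F]

open Classical in
/-- The pairs `(P, m)`, standing for the prime powers `P ^ (m + 1)`, of
degree at most `N`. -/
noncomputable def primePowerFinset (N : ℕ) : Finset (monicPrimes F × ℕ) :=
  ((((Finset.Icc 1 N).biUnion (primeFinset F)).subtype (· ∈ monicPrimes F)) ×ˢ
    Finset.range N).filter fun x => (x.1 : F[X]).natDegree * (x.2 + 1) ≤ N

theorem mem_primePowerFinset {N : ℕ} {x : monicPrimes F × ℕ} :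
    x ∈ primePowerFinset F N ↔ (x.1 : F[X]).natDegree * (x.2 + 1) ≤ N := by
  obtain ⟨⟨P, hP, hi⟩, m⟩ := x
  have hd : 1 ≤ P.natDegree := hi.natDegree_pos
  simp only [primePowerFinset, Finset.mem_filter, Finset.mem_product, Finset.mem_subtype,
    Finset.mem_biUnion, Finset.mem_Icc, Finset.mem_range, mem_primeFinset, and_iff_right_iff_imp]
  intro h
  have h1 := Nat.le_mul_of_pos_right P.natDegree (Nat.succ_pos m)
  have h2 := Nat.le_mul_of_pos_left (m + 1) hd
  exact ⟨⟨P.natDegree, ⟨hd, h1.trans h⟩, hP, rfl, hi⟩, by omega⟩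

theorem tendsto_primePowerFinset :
    Filter.Tendsto (primePowerFinset F) Filter.atTop Filter.atTop := by
  refine Filter.tendsto_atTop_finset_of_monotone (fun a b hab x hx => ?_) fun x =>
    ⟨_, (mem_primePowerFinset F).2 le_rfl⟩
  exact (mem_primePowerFinset F).2 (((mem_primePowerFinset F).1 hx).trans hab)

theorem sum_primePowerFinset (N : ℕ) (G : ℕ → ℕ → ℝ) :
    ∑ x ∈ primePowerFinset F N, G (x.1 : F[X]).natDegree (x.2 + 1) =
      ∑ l ∈ Finset.Icc 1 N, ∑ x ∈ l.divisorsAntidiagonal,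
        ((primeFinset F x.1).card : ℝ) * G x.1 x.2 := by
  classical
  rw [← sum_Icc_mul_eq_sum_divisorsAntidiagonal N (fun d m =>
    ((primeFinset F d).card : ℝ) * G d m), primePowerFinset, Finset.sum_filter,
    Finset.sum_product]
  rw [Finset.sum_subtype_of_mem (p := (· ∈ monicPrimes F)) (fun P : F[X] => ∑ m ∈ Finset.range N,
    if P.natDegree * (m + 1) ≤ N then G P.natDegree (m + 1) else 0)]
  · rw [Finset.sum_biUnion]
    · refine Finset.sum_congr rfl fun d _ => ?_
      rw [sum_Icc_one_eq_sum_range, Finset.sum_comm]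
      refine Finset.sum_congr rfl fun m _ => ?_
      rw [Finset.sum_congr rfl (g := fun _ => if d * (m + 1) ≤ N then G d (m + 1) else 0)
        (fun P hP => by rw [(mem_primeFinset.1 hP).2.1]), Finset.sum_const, nsmul_eq_mul]
      split_ifs <;> simp
    · intro a _ b _ hab
      refine Finset.disjoint_left.2 fun P ha hb => hab ?_
      rw [← (mem_primeFinset.1 ha).2.1, ← (mem_primeFinset.1 hb).2.1]
  · intro P hP
    obtain ⟨d, _, h⟩ := Finset.mem_biUnion.1 hP
    exact ⟨(mem_primeFinset.1 h).1, (mem_primeFinset.1 h).2.2⟩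

/-- The contribution `(r ^ m - r) / (m |P| ^ m)` of a prime power `P ^ m`, with `d = deg P`, to the
logarithm of the Euler product. -/
noncomputable def logFactorTerm (r : ℝ) (d m : ℕ) : ℝ :=
  (r ^ m - r) / ((m : ℝ) * (Nat.card F : ℝ) ^ (d * m))

variable {F}

theorem abs_pow_sub_self_le_powerWeight {r : ℝ} (h0 : 0 ≤ r) (h1 : r ≤ 9 / 5) {m : ℕ}
    (hm : 1 ≤ m) : |r ^ m - r| ≤ powerWeight m := by
  have := abs_eval_le_weightedNorm h0 h1 ((X : ℝ[X]) ^ m - X)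
  simp only [eval_sub, eval_pow, eval_X] at this
  exact this.trans (weightedNorm_X_pow_sub_X_le_powerWeight hm)

theorem eval_quotientLogPoly_div (r : ℝ) (l : ℕ) :
    (quotientLogPoly F l).eval r / ((l : ℝ) + 1) = ∑ x ∈ (l + 1).divisorsAntidiagonal,
      ((primeFinset F x.1).card : ℝ) * logFactorTerm F r x.1 x.2 := by
  rw [quotientLogPoly_eq, eval_finsetSum, Finset.sum_div]
  refine Finset.sum_congr rfl fun x hx => ?_
  obtain ⟨h1, h2⟩ := Nat.mem_divisorsAntidiagonal.1 hx
  rw [← h1] at h2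
  have hd : (x.1 : ℝ) ≠ 0 := by exact_mod_cast left_ne_zero_of_mul h2
  have hl : (l : ℝ) + 1 = x.1 * x.2 := by exact_mod_cast h1.symm
  simp only [eval_mul, eval_C, eval_sub, eval_pow, eval_X]
  rw [logFactorTerm, hl, ← h1]
  field_simp

theorem sum_abs_logFactorTerm_le {r : ℝ} (h0 : 0 ≤ r) (h1 : r ≤ 9 / 5) (N : ℕ) :
    ∑ x ∈ primePowerFinset F N, |logFactorTerm F r (x.1 : F[X]).natDegree (x.2 + 1)| ≤
      7800 / (Nat.card F : ℝ) := by
  have hq : (0 : ℝ) < Nat.card F := by linarith [two_le_natCard F]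
  rw [sum_primePowerFinset F N (fun d m => |logFactorTerm F r d m|)]
  refine le_trans ?_ (sum_primePower_le F N)
  refine Finset.sum_le_sum fun l _ => Finset.sum_le_sum fun x hx => ?_
  obtain ⟨h2, h3⟩ := Nat.mem_divisorsAntidiagonal.1 hx
  rw [← h2] at h3
  have hd : (1 : ℝ) ≤ x.1 := by
    exact_mod_cast Nat.one_le_iff_ne_zero.2 (left_ne_zero_of_mul h3)
  have hm' : 1 ≤ x.2 := Nat.one_le_iff_ne_zero.2 (right_ne_zero_of_mul h3)
  have hm : (1 : ℝ) ≤ x.2 := by exact_mod_cast hm'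
  have hpw := powerWeight_nonneg x.2
  rw [logFactorTerm, abs_div, abs_of_nonneg (by positivity :
    0 ≤ (x.2 : ℝ) * (Nat.card F : ℝ) ^ (x.1 * x.2))]
  calc ((primeFinset F x.1).card : ℝ) *
        (|r ^ x.2 - r| / ((x.2 : ℝ) * (Nat.card F : ℝ) ^ (x.1 * x.2)))
      ≤ ((primeFinset F x.1).card : ℝ) *
        (powerWeight x.2 / (1 * (Nat.card F : ℝ) ^ (x.1 * x.2))) := by
        gcongr
        exact abs_pow_sub_self_le_powerWeight h0 h1 hm'
    _ = 1 * ((primeFinset F x.1).card : ℝ) / (Nat.card F : ℝ) ^ (x.1 * x.2) *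
          powerWeight x.2 * 1 := by
        ring
    _ ≤ _ := by
        gcongr
        exact one_le_pow₀ (by norm_num)

theorem summable_logFactorTerm {r : ℝ} (h0 : 0 ≤ r) (h1 : r ≤ 9 / 5) :
    Summable fun x : monicPrimes F × ℕ =>
      |logFactorTerm F r (x.1 : F[X]).natDegree (x.2 + 1)| := by
  refine summable_of_sum_le (c := 7800 / (Nat.card F : ℝ)) (fun _ => abs_nonneg _) fun u => ?_
  obtain ⟨N, hN⟩ := ((tendsto_primePowerFinset F).eventually (Filter.eventually_ge_atTop u)).exists
  exact (Finset.sum_le_sum_of_subset_of_nonneg hN fun _ _ _ => abs_nonneg _).trans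
    (sum_abs_logFactorTerm_le h0 h1 N)

theorem hFactor_eq_exp {r : ℝ} (h0 : 0 ≤ r) (h1 : r ≤ 9 / 5) (P : monicPrimes F) :
    ∃ s : ℝ, HasSum (fun m : ℕ => logFactorTerm F r (P : F[X]).natDegree (m + 1)) s ∧
      hFactor r (P : F[X]) = Real.exp s := by
  obtain ⟨P, hP, hi⟩ := P
  have hq := two_le_natCard F
  have hnorm : (2 : ℝ) ≤ polyNorm P := by
    rw [polyNorm]
    exact hq.trans (le_self_pow₀ (by linarith) hi.natDegree_pos.ne')
  set t : ℝ := 1 / polyNorm P with ht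
  have ht0 : 0 < t := by positivity
  have ht1 : t ≤ 1 / 2 := by rw [ht]; gcongr
  have hrt : r / polyNorm P = r * t := by rw [ht]; ring
  have hrt1 : r * t < 1 := by nlinarith
  have hrt0 : 0 ≤ r * t := by positivity
  have e1 := Real.hasSum_pow_div_log_of_abs_lt_one (x := r * t) (by rwa [abs_of_nonneg hrt0])
  have e2 := Real.hasSum_pow_div_log_of_abs_lt_one (x := t)
    (by rw [abs_of_nonneg ht0.le]; linarith)
  refine ⟨-Real.log (1 - r * t) - r * -Real.log (1 - t), ?_, ?_⟩
  · refine (e1.sub (e2.mul_left r)).congr_fun ?_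
    intro m
    have : t ^ (m + 1) = 1 / (Nat.card F : ℝ) ^ (P.natDegree * (m + 1)) := by
      rw [ht, polyNorm, one_div_pow, ← pow_mul]
    rw [logFactorTerm, mul_pow, this]
    push_cast
    field_simp
  · rw [hFactor, hrt, Real.rpow_def_of_pos (by linarith), sub_eq_add_neg (-Real.log _),
      Real.exp_add,
      Real.exp_neg, Real.exp_log (by linarith)]
    congr 2
    ring

theorem abs_eval_quotientLogPoly_le {r : ℝ} (h0 : 0 ≤ r) (h1 : r ≤ 9 / 5) (l : ℕ) :
    |(quotientLogPoly F l).eval r| ≤ 7800 * (10 / 11) ^ l := by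
  have hq := two_le_natCard F
  have hnn := weightedNorm_nonneg (ρ := 9 / 5) (by norm_num)
  have h2 := (Finset.single_le_sum (f := fun l =>
    weightedNorm (9 / 5) (quotientLogPoly F l) * (11 / 10) ^ (l + 1))
    (fun l _ => mul_nonneg (hnn _) (by positivity)) (Finset.self_mem_range_succ l)).trans
    (sum_weightedNorm_quotientLogPoly_le F (l + 1))
  have h3 : 7800 / (Nat.card F : ℝ) ≤ 7800 := div_le_self (by norm_num) (by linarith)
  have h4 : (11 / 10 : ℝ) ^ l ≤ (11 / 10) ^ (l + 1) :=
    pow_le_pow_right₀ (by norm_num) (Nat.le_succ l)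
  refine (abs_eval_le_weightedNorm h0 h1 _).trans ?_
  rw [show (10 / 11 : ℝ) = (11 / 10)⁻¹ by norm_num, inv_pow, ← div_eq_mul_inv,
    le_div_iff₀ (by positivity)]
  exact ((mul_le_mul_of_nonneg_left h4 (hnn _)).trans h2).trans h3

theorem summable_eval_quotientLogPoly_div {r : ℝ} (h0 : 0 ≤ r) (h1 : r ≤ 9 / 5) :
    Summable fun l : ℕ => ‖(quotientLogPoly F l).eval r / ((l : ℝ) + 1)‖ := by
  refine Summable.of_nonneg_of_le (fun _ => norm_nonneg _) (fun l => ?_)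
    ((summable_geometric_of_lt_one (r := (10 / 11 : ℝ)) (by norm_num)
      (by norm_num)).mul_left 7800)
  rw [norm_div, Real.norm_eq_abs, Real.norm_eq_abs,
    abs_of_nonneg (by positivity : (0 : ℝ) ≤ (l : ℝ) + 1)]
  exact (div_le_self (abs_nonneg _) (by linarith [(Nat.cast_nonneg l : (0 : ℝ) ≤ l)])).trans
    (abs_eval_quotientLogPoly_le h0 h1 l)

/-- The logarithm of the Euler product, a sum over all prime powers, regrouped by their degree. -/
theorem hasProd_hFactor {r : ℝ} (h0 : 0 ≤ r) (h1 : r ≤ 9 / 5) :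
    HasProd (fun P : monicPrimes F => hFactor r (P : F[X]))
      (Real.exp (∑' l : ℕ, (quotientLogPoly F l).eval r / ((l : ℝ) + 1))) := by
  obtain ⟨s, hs⟩ := (summable_logFactorTerm (F := F) h0 h1).of_abs
  have hlim1 := hs.comp (tendsto_primePowerFinset F)
  have hlim2 := (summable_eval_quotientLogPoly_div (F := F) h0 h1).of_norm.hasSum.tendsto_sum_nat
  have heq : ((fun u => ∑ x ∈ u, logFactorTerm F r (x.1 : F[X]).natDegree (x.2 + 1)) ∘
      primePowerFinset F) =
      fun N => ∑ l ∈ Finset.range N, (quotientLogPoly F l).eval r / ((l : ℝ) + 1) := by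
    funext N
    simp only [Function.comp]
    rw [sum_primePowerFinset F N (logFactorTerm F r), sum_Icc_one_eq_sum_range]
    exact Finset.sum_congr rfl fun l _ => (eval_quotientLogPoly_div r l).symm
  rw [heq] at hlim1
  rw [← tendsto_nhds_unique hlim1 hlim2]
  choose g hg hgexp using hFactor_eq_exp (F := F) h0 h1
  have h2 := (hs.prod_fiberwise hg).rexp
  refine h2.congr_fun ?_
  exact fun P => hgexp P

theorem hFun_eq_exp {r : ℝ} (h0 : 0 ≤ r) (h1 : r ≤ 9 / 5) :
    hFun F r = Real.exp (∑' l : ℕ, (quotientLogPoly F l).eval r / ((l : ℝ) + 1)) :=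
  (hasProd_hFactor h0 h1).tprod_eq

theorem exp_neg_le_hFun {r : ℝ} (h0 : 0 ≤ r) (h1 : r ≤ 9 / 5) : Real.exp (-7800) ≤ hFun F r := by
  have hq := two_le_natCard F
  rw [hFun_eq_exp h0 h1]
  refine Real.exp_le_exp.2 (neg_le_of_abs_le ?_)
  refine (norm_tsum_le_tsum_norm (summable_eval_quotientLogPoly_div h0 h1)).trans ?_
  refine Real.tsum_le_of_sum_range_le (fun _ => norm_nonneg _) fun N => ?_
  refine le_trans ?_ ((sum_weightedNorm_quotientLogPoly_le F N).trans
    (div_le_self (by norm_num) (by linarith)))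
  refine Finset.sum_le_sum fun l _ => ?_
  rw [norm_div, Real.norm_eq_abs, Real.norm_eq_abs,
    abs_of_nonneg (by positivity : (0 : ℝ) ≤ (l : ℝ) + 1)]
  have h2 := abs_eval_le_weightedNorm h0 h1 (quotientLogPoly F l)
  have h3 : (1 : ℝ) ≤ (11 / 10) ^ (l + 1) := one_le_pow₀ (by norm_num)
  refine (div_le_self (abs_nonneg _) (by linarith [(Nat.cast_nonneg l : (0 : ℝ) ≤ l)])).trans
    (h2.trans (le_mul_of_one_le_right ((abs_nonneg _).trans h2) h3))

end EulerProduct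

/-! ### Comparison of the two distributions -/

theorem cycleRatio_eq_zero {n k j i : ℕ} (h : ¬(j ≤ n ∧ i ≤ k)) : cycleRatio n k j i = 0 :=
  if_neg h

section Comparison

variable {F : Type*} [Field F] [Finite F]

theorem probOmega_div_eq_sum (n k : ℕ) :
    probOmega F n k / probCycles n k = ∑ j ∈ Finset.range (n + 1),
      (quotientPoly F j).sum fun i a => a * cycleRatio n k j i := by
  rw [probOmega_eq_sum, Finset.sum_div]
  refine Finset.sum_congr rfl fun j hj => ?_
  have hj' : j ≤ n := Nat.lt_succ_iff.1 (Finset.mem_range.1 hj)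
  rw [sum_over_range' _ (by simp) (max (quotientPoly F j).natDegree k + 1) (by omega),
    Finset.sum_div]
  refine (Finset.sum_congr rfl fun i hi => ?_).trans
    (Finset.sum_subset (Finset.range_subset_range.2 (by omega)) fun i _ hi => ?_)
  · have hi' : i ≤ k := Nat.lt_succ_iff.1 (Finset.mem_range.1 hi)
    rw [cycleRatio, if_pos ⟨hj', hi'⟩, mul_div_assoc]
  · rw [cycleRatio_eq_zero (fun h => hi (Finset.mem_range.2 (by omega))), mul_zero]

theorem abs_quotientPoly_sum_sub_eval_le {n k j : ℕ} {r B : ℝ}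
    (hB : ∀ i, |cycleRatio n k j i - r ^ i| ≤ B * (9 / 5) ^ i) :
    |((quotientPoly F j).sum fun i a => a * cycleRatio n k j i) - (quotientPoly F j).eval r| ≤
      B * weightedNorm (9 / 5) (quotientPoly F j) := by
  rw [eval_eq_sum, weightedNorm, sum_def, sum_def, sum_def, ← Finset.sum_sub_distrib,
    Finset.mul_sum]
  refine (Finset.abs_sum_le_sum_abs _ _).trans (Finset.sum_le_sum fun i _ => ?_)
  rw [← mul_sub, abs_mul, mul_left_comm]
  exact mul_le_mul_of_nonneg_left (hB i) (abs_nonneg _)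

theorem eval_quotientPoly_recurrence (r : ℝ) (n : ℕ) :
    ((n : ℝ) + 1) * (quotientPoly F (n + 1)).eval r =
      ∑ x ∈ Finset.HasAntidiagonal.antidiagonal n,
        (quotientLogPoly F x.1).eval r * (quotientPoly F x.2).eval r := by
  have h := congrArg (eval r) (quotientPoly_recurrence F n)
  rw [eval_finsetSum] at h
  simpa using h

theorem hFun_eq_tsum {r D : ℝ} (h0 : 0 ≤ r) (h1 : r ≤ 9 / 5) (hD : 0 < D)
    (hF : ∀ j, 1 ≤ j →
      weightedNorm (9 / 5) (quotientPoly F j) ≤ D / (Nat.card F : ℝ) * (10 / 11) ^ j) :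
    Summable (fun j => (quotientPoly F j).eval r) ∧
      hFun F r = ∑' j, (quotientPoly F j).eval r := by
  have hq := two_le_natCard F
  have hb : ∀ j, |(quotientPoly F j).eval r| ≤ (D + 7800) * (10 / 11) ^ j := by
    intro j
    rcases Nat.eq_zero_or_pos j with rfl | hj
    · rw [quotientPoly_zero]; simp; linarith
    · refine (abs_eval_le_weightedNorm h0 h1 _).trans ((hF j hj).trans ?_)
      gcongr
      exact (div_le_self hD.le (by linarith)).trans (by linarith)
  refine ⟨?_, ?_⟩
  · have := (summable_mul_pow_of_abs_le (u := 1) (by norm_num) hb (by norm_num)).of_norm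
    simpa using this
  · rw [hFun_eq_exp h0 h1]
    refine (tsum_eq_exp_of_recurrence (A := D + 7800) ?_ hb (fun l => ?_)
      (eval_quotientPoly_recurrence r)).symm
    · simp [quotientPoly_zero]
    · refine (abs_eval_quotientLogPoly_le h0 h1 l).trans ?_
      gcongr
      linarith

end Comparison

theorem exists_abs_probOmega_div_sub_hFun_le :
    ∃ C : ℝ, 0 < C ∧
      ∀ (F : Type u) [Field F] [Finite F] (n k : ℕ), 2 ≤ n → 1 ≤ k → k ≤ n →
        rParam n k ≤ 3 / 2 →
          |probOmega F n k / probCycles n k - hFun F (rParam n k)| ≤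
            C * (k : ℝ) / ((Nat.card F : ℝ) * Real.log (n : ℝ) ^ 2) := by
  obtain ⟨D, hD0, hD⟩ := exists_weightedNorm_quotientPoly_le.{u}
  obtain ⟨C, hC0, hC⟩ := exists_abs_cycleRatio_sub_pow_le
  have hS : Summable fun j : ℕ => (j : ℝ) ^ 2 * (10 / 11 : ℝ) ^ j :=
    summable_pow_mul_geometric_of_norm_lt_one 2 (by rw [Real.norm_eq_abs, abs_of_pos] <;> norm_num)
  set S := ∑' j : ℕ, (j : ℝ) ^ 2 * (10 / 11 : ℝ) ^ j
  refine ⟨C * D * (S + 1), by positivity, ?_⟩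
  intro F _ _ n k hn hk hkn hr
  have hr0 := rParam_nonneg (n := n) hk
  obtain ⟨hsum, heq⟩ := hFun_eq_tsum (F := F) hr0 (by linarith) hD0 (hD F)
  set r := rParam n k
  set T : ℕ → ℝ := fun j => (quotientPoly F j).sum fun i a => a * cycleRatio n k j i with hT
  have hTfin : ∀ j ∉ Finset.range (n + 1), T j = 0 := by
    intro j hj
    simp only [hT, sum_def]
    refine Finset.sum_eq_zero fun i _ => ?_
    rw [cycleRatio_eq_zero (fun h => hj (Finset.mem_range.2 (by omega))), mul_zero]
  have hTsum : probOmega F n k / probCycles n k = ∑' j, T j := by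
    rw [probOmega_div_eq_sum, tsum_eq_sum hTfin]
  have hTs : Summable T := summable_of_ne_finset_zero hTfin
  have hterm : ∀ j, ‖T j - (quotientPoly F j).eval r‖ ≤
      C * D * (k / ((Nat.card F : ℝ) * Real.log n ^ 2)) * ((j : ℝ) ^ 2 * (10 / 11) ^ j) := by
    intro j
    rw [Real.norm_eq_abs]
    rcases Nat.eq_zero_or_pos j with rfl | hj
    · have h1 : T 0 = 1 := by
        have : (1 : ℝ[X]) = Polynomial.C (1 : ℝ) := by simp
        simp only [hT, quotientPoly_zero]
        rw [this, sum_C_index (by simp), cycleRatio, if_pos ⟨by omega, by omega⟩]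
        simp [div_self (probCycles_pos hk hkn).ne']
      rw [h1, quotientPoly_zero]
      simp
    · have h1 := abs_quotientPoly_sum_sub_eval_le (F := F) (n := n) (k := k) (j := j) (r := r)
        (B := C * j ^ 2 * (k / Real.log n ^ 2)) fun i =>
          (hC n k j i hn hk hkn hr hj).trans_eq (by ring)
      refine h1.trans ((mul_le_mul_of_nonneg_left (hD F j hj) (by positivity)).trans_eq ?_)
      field_simp
  have hmaj := hS.mul_left (C * D * (k / ((Nat.card F : ℝ) * Real.log n ^ 2)))
  rw [hTsum, heq, ← hTs.tsum_sub hsum, ← Real.norm_eq_abs]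
  refine (tsum_of_norm_bounded hmaj.hasSum hterm).trans ?_
  rw [tsum_mul_left]
  have : C * D * (k / ((Nat.card F : ℝ) * Real.log n ^ 2)) * S ≤
      C * D * (k / ((Nat.card F : ℝ) * Real.log n ^ 2)) * (S + 1) := by
    gcongr; linarith
  refine this.trans_eq ?_
  ring

theorem corollary1p1 :
    -- the Euler product defining `h_q(r)` converges
    (∀ (F : Type u) [Field F] [Finite F] (n k : ℕ), 2 ≤ n → 1 ≤ k → k ≤ n →
      rParam n k ≤ 3 / 2 →
        Multipliable (fun P : monicPrimes F => hFactor (rParam n k) (P : Polynomial F))) ∧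
    -- the inequality, with an absolute constant
    (∃ C : ℝ, 0 < C ∧
      ∀ (F : Type u) [Field F] [Finite F] (n k : ℕ), 2 ≤ n → 1 ≤ k → k ≤ n →
        rParam n k ≤ 3 / 2 →
          |probOmega F n k / probCycles n k - hFun F (rParam n k)| ≤
            C * (k : ℝ) / ((Nat.card F : ℝ) * Real.log (n : ℝ) ^ 2)) ∧
    -- the asymptotic formula as `q ^ n → ∞`, uniformly in `q`, `n` and `k`
    (∀ ε : ℝ, 0 < ε → ∃ N : ℕ,
      ∀ (F : Type u) [Field F] [Finite F] (n k : ℕ), 2 ≤ n → 1 ≤ k → k ≤ n →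
        rParam n k ≤ 3 / 2 → N ≤ Nat.card F ^ n →
          |probOmega F n k / (probCycles n k * hFun F (rParam n k)) - 1| ≤ ε) := by
  refine ⟨fun F _ _ n k _ hk _ hr =>
    (hasProd_hFactor (rParam_nonneg hk) (by linarith)).multipliable,
    exists_abs_probOmega_div_sub_hFun_le, fun ε hε => ?_⟩
  obtain ⟨C, hC0, hC⟩ := exists_abs_probOmega_div_sub_hFun_le.{u}
  have hlog2 : (1 / 2 : ℝ) < Real.log 2 := by linarith [Real.log_two_gt_d9]
  -- As `k ≤ 1 + (3/2) log n`, the relative error is at most `A / (q log n)`.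
  set A : ℝ := C * (7 / 2) / Real.exp (-7800) with hA
  set Q : ℕ := ⌈2 * A / ε⌉₊
  set M : ℕ := ⌈Real.exp (A / ε)⌉₊
  refine ⟨(Q + 1) ^ (M + 1), ?_⟩
  intro F _ _ n k hn hk hkn hr hN
  have hr0 := rParam_nonneg (n := n) hk
  have hq := two_le_natCard F
  have hq0 : (0 : ℝ) < Nat.card F := by linarith
  have hn' : (2 : ℝ) ≤ n := by exact_mod_cast hn
  have hlogn : Real.log 2 ≤ Real.log n := Real.log_le_log (by norm_num) hn'
  have hL : 0 < Real.log n := by linarith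
  have hk' : (k : ℝ) ≤ 7 / 2 * Real.log n := by
    rw [rParam, div_le_iff₀ hL] at hr
    linarith
  have hh := exp_neg_le_hFun (F := F) hr0 (by linarith)
  have hhpos : 0 < hFun F (rParam n k) := (Real.exp_pos _).trans_le hh
  have hdecomp : probOmega F n k / (probCycles n k * hFun F (rParam n k)) - 1 =
      (probOmega F n k / probCycles n k - hFun F (rParam n k)) / hFun F (rParam n k) := by
    rw [sub_div, div_self hhpos.ne', div_div]
  have hbound : |probOmega F n k / (probCycles n k * hFun F (rParam n k)) - 1| ≤
      A / ((Nat.card F : ℝ) * Real.log n) := by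
    rw [hdecomp, abs_div, abs_of_pos hhpos]
    calc _ ≤ C * (k : ℝ) / ((Nat.card F : ℝ) * Real.log (n : ℝ) ^ 2) / Real.exp (-7800) := by
          gcongr
          exact hC F n k hn hk hkn hr
      _ ≤ C * (7 / 2 * Real.log n) / ((Nat.card F : ℝ) * Real.log (n : ℝ) ^ 2) /
          Real.exp (-7800) := by gcongr
      _ = _ := by rw [hA]; field_simp
  refine hbound.trans ?_
  rw [div_le_iff₀ (by positivity)]
  by_contra hcon
  rw [not_le] at hcon
  have hqQ : Nat.card F ≤ Q := by
    have h1 : (Nat.card F : ℝ) * ε < 2 * A := by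
      nlinarith [mul_pos hε hq0]
    have h2 : (Nat.card F : ℝ) ≤ 2 * A / ε := by rw [le_div_iff₀ hε]; exact h1.le
    exact_mod_cast h2.trans (Nat.le_ceil _)
  have hnM : n ≤ M := by
    have h1 : Real.log n * ε ≤ A := by
      nlinarith [mul_pos hε hL]
    have h2 : Real.log n ≤ A / ε := by rw [le_div_iff₀ hε]; exact h1
    have h3 : (n : ℝ) ≤ Real.exp (A / ε) := (Real.log_le_iff_le_exp (by linarith)).1 h2
    exact_mod_cast h3.trans (Nat.le_ceil _)
  have : Nat.card F ^ n < (Q + 1) ^ (M + 1) :=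
    calc Nat.card F ^ n ≤ (Q + 1) ^ n := Nat.pow_le_pow_left (by omega) n
      _ < (Q + 1) ^ (M + 1) := Nat.pow_lt_pow_right
          (by have : 2 ≤ Nat.card F := by exact_mod_cast hq
              omega) (by omega)
  omega
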